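/- For a nonzero polynomial $P\in\mathbb{C}[x_1,\dots,x_n]$ let \[ m(P)=\int_0^1\!\cdots\!\int_0^1 \log|P(e^{2\pi i\theta_1},\dots,e^{2\pi i\theta_n})|\,d\theta_1\cdots d\theta_n \] be its (logarithmic) Mahler measure, and for nowhere vanishing complex-valued functions $f,g,h$ let \[ \eta(f,g,h)=\sum_{\mathrm{cyc}}\log|f|\left(\tfrac13\,d\log|g|\wedge d\log|h| + d\,i\arg g\wedge d\,i\arg h\right), \] the sum being over the three cyclic permutations of $(f,g,h)$. Let $P=1+x+2xy-(1-x)z$, $Q=1+x+2y+(1-x)z$, and on the surface $P=0$ write $z=\frac{1+x+2xy}{1-x}$. 1. The integrals defining $m(P)$ and $m(Q)$ converge absolutely, and \[ m(P)=m(Q)=\frac{7}{2\pi^2}\,\zeta(3)+\frac{\log 2}{2}. \] 2. The regulator form $\eta(x,y,z)$ is not exact on the surface $P=0$, not even at its generic point: for every nonzero polynomial $f(x,y)$, $\eta(x,y,z)$ is not the exterior derivative of a $C^\infty$ $1$-form on the Zariski open set $\{(x,y)\in\mathbb{C}^2 : x\,y\,(1-x)(1+x+2xy)\,f(x,y)\neq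 0\}$, where $(x,y)$ are used as coordinates on the surface. 3. Let $B=\{(\alpha,\beta)\in[-\pi,\pi]^2 : -\pi\le\alpha+\beta\le\pi\}$, oriented by $d\alpha\wedge d\beta$, and put $x=e^{i\alpha}$, $y=e^{i\beta}$, $z=\frac{1+x+2xy}{1-x}$. Then $\eta(2,x,z)$ is absolutely integrable over $B$, \[ \int_B\eta(2,x,z)=-2\pi^2\log 2, \qquad 4\pi^2\,m(P)=14\,\zeta(3)-\int_B\eta(2,x,z). \] -/

import Mathlib

open scoped ContDiff

/-- The integrand `θ ↦ log |P(e^{2πiθ_1}, …, e^{2πiθ_n})|` of the Mahler measure. -/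
noncomputable def mahlerIntegrand {n : ℕ} (P : MvPolynomial (Fin n) ℂ) (θ : Fin n → ℝ) : ℝ :=
  Real.log ‖MvPolynomial.eval
    (fun j => Complex.exp (2 * (Real.pi : ℂ) * Complex.I * (θ j : ℂ))) P‖

/-- The logarithmic Mahler measure
`m(P) = ∫_{[0,1]^n} log |P(e^{2πiθ_1}, …, e^{2πiθ_n})| dθ_1 ⋯ dθ_n`. -/
noncomputable def logMahler {n : ℕ} (P : MvPolynomial (Fin n) ℂ) : ℝ :=
  ∫ θ in Set.Icc (0 : Fin n → ℝ) 1, mahlerIntegrand P θ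

section Forms

variable {E : Type*} [NormedAddCommGroup E] [NormedSpace ℝ E]

/-- The wedge product `α ∧ β` of two real covectors:
`(α ∧ β)(v, w) = α v * β w - α w * β v`. -/
noncomputable def wedge (α β : E →L[ℝ] ℝ) : E [⋀^Fin 2]→L[ℝ] ℝ :=
  ContinuousMultilinearMap.alternatization
    ((ContinuousMultilinearMap.mkPiAlgebra ℝ (Fin 2) ℝ).compContinuousLinearMap ![α, β])

theorem wedge_apply (α β : E →L[ℝ] ℝ) (v : Fin 2 → E) :
    wedge α β v = α (v 0) * β (v 1) - α (v 1) * β (v 0) := by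
  have h : (Finset.univ : Finset (Equiv.Perm (Fin 2))) = {1, Equiv.swap 0 1} := by decide
  rw [wedge, ContinuousMultilinearMap.alternatization_apply_apply, h,
    Finset.sum_pair (by decide)]
  simp [Fin.prod_univ_two, sub_eq_add_neg]

/-- The logarithmic derivative `df / f` of a complex-valued function, as a real-linear map. -/
noncomputable def dLogC (f : E → ℂ) (p : E) : E →L[ℝ] ℂ := (f p)⁻¹ • fderiv ℝ f p

/-- The 1-form `d log |f| = Re (df / f)`. -/
noncomputable def dLogAbs (f : E → ℂ) (p : E) : E →L[ℝ] ℝ := Complex.reCLM.comp (dLogC f p)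

/-- The 1-form `d arg f = Im (df / f)`. -/
noncomputable def dArg (f : E → ℂ) (p : E) : E →L[ℝ] ℝ := Complex.imCLM.comp (dLogC f p)

/-- One summand of the regulator form:
`log |f| (1/3 d log |g| ∧ d log |h| + (i d arg g) ∧ (i d arg h))`; the factor `i * i = -1`
is multiplied out. -/
noncomputable def etaSummand (f g h : E → ℂ) (p : E) : E [⋀^Fin 2]→L[ℝ] ℝ :=
  Real.log ‖f p‖ •
    ((1 / 3 : ℝ) • wedge (dLogAbs g p) (dLogAbs h p) - wedge (dArg g p) (dArg h p))

/-- The regulator 2-form `η(f, g, h)`, on the set where `f`, `g`, `h` do not vanish. -/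
noncomputable def regulatorForm (f g h : E → ℂ) (p : E) : E [⋀^Fin 2]→L[ℝ] ℝ :=
  etaSummand f g h p + etaSummand g h f p + etaSummand h f g p

/-- A differential 2-form is exact on an open set `V` if it is the exterior derivative of a
smooth 1-form on `V`. -/
def IsExactFormOn (η : E → E [⋀^Fin 2]→L[ℝ] ℝ) (V : Set E) : Prop :=
  ∃ φ : E → E [⋀^Fin 1]→L[ℝ] ℝ, ContDiffOn ℝ ∞ φ V ∧ ∀ p ∈ V, extDeriv φ p = η p

end Forms

/-- The function `z = (1 + x + 2xy) / (1 - x)`; its graph is the surface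
`1 + x + 2xy - (1 - x) z = 0`. -/
noncomputable def zOf (x y : ℂ) : ℂ := (1 + x + 2 * x * y) / (1 - x)

/-- The surface `1 + x + 2xy - (1 - x) z = 0` in the coordinates `(x, y)`, without the zeros and
the poles of `x`, `y`, `z` and without the zero set of a further polynomial `f(x, y)`. For
`f ≠ 0` these are the principal Zariski open subsets on which `x`, `y`, `z` are regular and
nowhere zero. -/
def surfaceOpen (f : MvPolynomial (Fin 2) ℂ) : Set (ℂ × ℂ) :=
  {p | p.1 ≠ 0 ∧ p.2 ≠ 0 ∧ 1 - p.1 ≠ 0 ∧ 1 + p.1 + 2 * p.1 * p.2 ≠ 0 ∧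
    MvPolynomial.eval ![p.1, p.2] f ≠ 0}

/-- The form `η(x, y, z)` on the surface, in the coordinates `(x, y)`. -/
noncomputable def etaSurface : ℂ × ℂ → (ℂ × ℂ) [⋀^Fin 2]→L[ℝ] ℝ :=
  regulatorForm (fun p => p.1) (fun p => p.2) (fun p => zOf p.1 p.2)

/-- The region `B` of the torus, in the angles `α = arg x`, `β = arg y`. -/
def regionB : Set (ℝ × ℝ) :=
  {t | t.1 ∈ Set.Icc (-Real.pi) Real.pi ∧ t.2 ∈ Set.Icc (-Real.pi) Real.pi ∧
    t.1 + t.2 ∈ Set.Icc (-Real.pi) Real.pi}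

/-- The coefficient of `dα ∧ dβ` in the form `η(2, x, z)` for `x = e^{iα}`, `y = e^{iβ}`. -/
noncomputable def etaTwoCoeff (t : ℝ × ℝ) : ℝ :=
  regulatorForm (fun _ : ℝ × ℝ => (2 : ℂ))
    (fun s => Complex.exp ((s.1 : ℂ) * Complex.I))
    (fun s => zOf (Complex.exp ((s.1 : ℂ) * Complex.I)) (Complex.exp ((s.2 : ℂ) * Complex.I)))
    t ![(1, 0), (0, 1)]

/-- The polynomial `1 + x + 2xy - (1 - x) z`. -/
noncomputable def polyP : MvPolynomial (Fin 3) ℂ :=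
  1 + .X 0 + 2 * .X 0 * .X 1 - (1 - .X 0) * .X 2

/-- The polynomial `1 + x + 2y + (1 - x) z`. -/
noncomputable def polyQ : MvPolynomial (Fin 3) ℂ :=
  1 + .X 0 + 2 * .X 1 + (1 - .X 0) * .X 2

open MeasureTheory intervalIntegral

/-! Both polynomials are affine in `y`: on the torus the coefficient of `y` (`2x` or `2`) has
modulus 2, and the constant term is `1 + x ∓ (1 - x) z`. As `|1 + x|² + |1 - x|² = 4` and `(1 + x)`
times the conjugate of `1 - x` is purely imaginary, its squared modulus is `4 (1 ∓ sin a sin b)`,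
with `a = arg x`, `b = arg z`. Jensen's formula in `y` (`integral_log_norm_add_mul_exp`) leaves `log
2 + ½ log⁺(1 ∓ sin a sin b)` to be averaged. Folding both angles to a quarter period removes the
sign and the truncation, so everything rests on the integral of `log (1 + cos φ cos b)` over `[0,
π/2]²`. Integration by parts in `φ` and Fubini reduce it to two single integrals: one gives `ζ(3)`,
from the Fourier series of `u (π - u)` divided by `sin u`, the other `π log 2`.

On the torus `|x| = 1` and 2 is constant, so `η(2, x, z)` is `-log 2 · dα ∧ d arg z`. For each fixed
`α ≠ 0`, `arg z` grows by exactly `π` across the section of `B`, hence the integral `-log 2 · 2π ·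
π`.

Non-exactness is detected by a nonzero period. On a small torus `|x| = r`, `|z| = s` in the surface,
the coefficient of `η(x, y, z)` is the real part of a function holomorphic in `x` and in `z`; the
mean value property, used twice, gives the period `-4π² log 2`, while Stokes
(`integral_extDeriv_periodic_eq_zero`) would give 0. Suitable radii keep the torus away from `f = 0`
(`exists_radii`), so removing a curve does not help. -/

/-! ### Evaluation of the double integral of `log (1 + cos φ cos b)`. -/

theorem two_mul_add_one_injective : Function.Injective (fun k : ℕ => 2 * k + 1) :=
  fun a b h => by simpa using h

/-- The Fourier series of `u (π - u)` on `[0, π]`. -/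
theorem hasSum_sin_odd_div_cube {u : ℝ} (h0 : 0 ≤ u) (h1 : u ≤ Real.pi) :
    HasSum (fun k : ℕ => Real.sin ((2 * k + 1) * u) / (2 * k + 1 : ℝ) ^ 3)
      (Real.pi / 8 * (u * (Real.pi - u))) := by
  have hpi := Real.pi_pos
  have hB : ∀ x : ℝ, (Polynomial.map (algebraMap ℚ ℝ) (Polynomial.bernoulli (2 * 1 + 1))).eval x =
      x ^ 3 - 3 / 2 * x ^ 2 + x / 2 := by
    intro x
    simp [Polynomial.bernoulli, Finset.sum_range_succ, bernoulli_eq_bernoulli'_of_ne_one,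
      bernoulli'_two, bernoulli'_three, bernoulli_one, Nat.choose]
    ring
  have key : ∀ x : ℝ, x ∈ Set.Icc (0 : ℝ) 1 →
      HasSum (fun n : ℕ => 1 / (n : ℝ) ^ 3 * Real.sin (2 * Real.pi * n * x))
        ((2 * Real.pi) ^ 3 / 12 * (x ^ 3 - 3 / 2 * x ^ 2 + x / 2)) := by
    intro x hx
    have h := hasSum_one_div_nat_pow_mul_sin (k := 1) one_ne_zero hx
    rw [hB] at h
    convert h using 1
    have : ((2 * 1 + 1).factorial : ℝ) = 6 := by norm_num [Nat.factorial]
    rw [this]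
    ring
  -- The argument `u / 2π` gives all frequencies `n`; `u / π` gives the even ones, weighted by 8.
  -- Their difference leaves the odd terms.
  have hS := key (u / (2 * Real.pi)) ⟨by positivity, by rw [div_le_one (by positivity)]; linarith⟩
  have hE := key (u / Real.pi) ⟨by positivity, by rw [div_le_one (by positivity)]; linarith⟩
  set f := (fun n : ℕ => 1 / (n : ℝ) ^ 3 *
      Real.sin (2 * Real.pi * n * (u / (2 * Real.pi)))) with hf
  have hodd := hS.summable.comp_injective two_mul_add_one_injective
  have heven : HasSum (fun k : ℕ => f (2 * k)) (1 / 8 * ((2 * Real.pi) ^ 3 / 12 *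
        ((u / Real.pi) ^ 3 - 3 / 2 * (u / Real.pi) ^ 2 + u / Real.pi / 2))) := by
    refine HasSum.congr_fun (hE.mul_left (1 / 8)) ?_
    intro k
    have : 2 * Real.pi * ((2 * k : ℕ) : ℝ) * (u / (2 * Real.pi)) =
        2 * Real.pi * k * (u / Real.pi) := by
      push_cast; field_simp
    simp only [hf, this]
    push_cast
    rw [mul_pow, one_div, one_div, one_div, mul_inv]
    ring
  have htot := (heven.even_add_odd hodd.hasSum).unique hS
  have hval : Real.pi / 8 * (u * (Real.pi - u)) =
      ∑' k : ℕ, (f ∘ (fun k : ℕ => 2 * k + 1)) k := by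
    rw [← sub_eq_iff_eq_add'.mpr htot.symm]
    field_simp
    ring
  rw [hval]
  refine hodd.hasSum.congr_fun ?_
  intro k
  have : 2 * Real.pi * ((2 * k + 1 : ℕ) : ℝ) * (u / (2 * Real.pi)) = (2 * k + 1) * u := by
    push_cast; field_simp
  simp only [hf, Function.comp, this]
  push_cast
  ring

/-- Supplies the summable bound `1 / (2k+1)²` for the Fourier series divided by `sin u`. -/
theorem abs_sin_nat_mul_le (n : ℕ) (u : ℝ) : |Real.sin (n * u)| ≤ n * |Real.sin u| := by
  induction n with
  | zero => simp
  | succ n ih =>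
    have : ((n + 1 : ℕ) : ℝ) * u = n * u + u := by push_cast; ring
    rw [this, Real.sin_add]
    calc |Real.sin (n * u) * Real.cos u + Real.cos (n * u) * Real.sin u|
        ≤ |Real.sin (n * u) * Real.cos u| + |Real.cos (n * u) * Real.sin u| := abs_add_le _ _
      _ ≤ n * |Real.sin u| * 1 + 1 * |Real.sin u| := by
          rw [abs_mul, abs_mul]
          gcongr
          · exact Real.abs_cos_le_one _
          · exact Real.abs_cos_le_one _
      _ = _ := by push_cast; ring

/-- Dirichlet kernel: consecutive quotients differ by `2 cos ((2k+2) u)`, whose integral over `[0,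
π/2]` vanishes. -/
theorem integral_sin_odd_div_sin (k : ℕ) :
    IntervalIntegrable (fun u => Real.sin ((2 * k + 1) * u) / Real.sin u) volume 0 (Real.pi / 2) ∧
    ∫ u in (0 : ℝ)..(Real.pi / 2), Real.sin ((2 * k + 1) * u) / Real.sin u = Real.pi / 2 := by
  have hpi := Real.pi_pos
  have hsin : ∀ u ∈ Set.uIoc 0 (Real.pi / 2), Real.sin u ≠ 0 := by
    intro u hu
    rw [Set.uIoc_of_le (by positivity)] at hu
    exact (Real.sin_pos_of_pos_of_lt_pi hu.1 (by linarith [hu.2])).ne'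
  induction k with
  | zero =>
    have h : Set.EqOn (fun _ => (1 : ℝ)) (fun u => Real.sin ((2 * (0 : ℕ) + 1) * u) / Real.sin u)
        (Set.uIoc 0 (Real.pi / 2)) := by
      intro u hu
      simp [div_self (hsin u hu)]
    refine ⟨(intervalIntegrable_const (c := (1 : ℝ))).congr h, ?_⟩
    rw [← intervalIntegral.integral_congr_ae (Filter.Eventually.of_forall h)]
    simp
  | succ k ih =>
    have h : Set.EqOn (fun u => Real.sin ((2 * k + 1) * u) / Real.sin u
          + 2 * Real.cos ((2 * k + 2) * u))
        (fun u => Real.sin ((2 * (k + 1 : ℕ) + 1) * u) / Real.sin u)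
        (Set.uIoc 0 (Real.pi / 2)) := by
      intro u hu
      have h1 : (2 * ((k + 1 : ℕ) : ℝ) + 1) * u = (2 * k + 2) * u + u := by push_cast; ring
      have h2 : (2 * (k : ℝ) + 1) * u = (2 * k + 2) * u - u := by ring
      simp only [h1, h2, Real.sin_add, Real.sin_sub]
      field_simp [hsin u hu]
      ring
    have hc : IntervalIntegrable (fun u : ℝ => 2 * Real.cos ((2 * k + 2) * u)) volume 0
        (Real.pi / 2) := (by fun_prop : Continuous _).intervalIntegrable _ _
    refine ⟨(ih.1.add hc).congr h, ?_⟩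
    rw [← intervalIntegral.integral_congr_ae (Filter.Eventually.of_forall h), intervalIntegral.integral_add ih.1 hc, ih.2,
      intervalIntegral.integral_const_mul,
      intervalIntegral.integral_comp_mul_left (fun x => Real.cos x) (by positivity)]
    have : (2 * (k : ℝ) + 2) * (Real.pi / 2) = ((k + 1 : ℕ) : ℝ) * Real.pi := by push_cast; ring
    rw [integral_cos, this, Real.sin_nat_mul_pi]
    simp

theorem hasSum_one_div_odd_cube :
    HasSum (fun k : ℕ => 1 / (2 * k + 1 : ℝ) ^ 3) (7 / 8 * ∑' n : ℕ, 1 / (n : ℝ) ^ 3) := by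
  have hs : Summable (fun n : ℕ => 1 / (n : ℝ) ^ 3) :=
    Real.summable_one_div_nat_pow.mpr (by norm_num)
  set f := (fun n : ℕ => 1 / (n : ℝ) ^ 3) with hf
  have hodd := hs.comp_injective two_mul_add_one_injective
  have heven : HasSum (fun k : ℕ => f (2 * k)) (1 / 8 * ∑' n : ℕ, f n) := by
    refine HasSum.congr_fun (hs.hasSum.mul_left (1 / 8)) ?_
    intro k
    simp only [hf]
    push_cast
    rw [mul_pow, one_div, one_div, one_div, mul_inv]
    ring
  have htot := (heven.even_add_odd hodd.hasSum).unique hs.hasSum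
  have : 7 / 8 * ∑' n : ℕ, f n = ∑' k : ℕ, (f ∘ (fun k : ℕ => 2 * k + 1)) k := by
    linarith
  rw [this]
  refine hodd.hasSum.congr_fun ?_
  intro k
  simp only [hf, Function.comp]
  push_cast
  rfl

/-- Dividing the Fourier series by `sin u` and integrating termwise gives `π/2 · 7/8 · ζ(3)` for
`π/8` times this integral. -/
theorem integral_mul_pi_sub_div_sin :
    ∫ u in (0 : ℝ)..(Real.pi / 2), u * (Real.pi - u) / Real.sin u =
      7 / 2 * ∑' n : ℕ, 1 / (n : ℝ) ^ 3 := by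
  have hpi := Real.pi_pos
  have hs2 := (Real.summable_one_div_nat_pow.mpr (by norm_num : 1 < 2)).comp_injective
    two_mul_add_one_injective
  have h := intervalIntegral.hasSum_integral_of_dominated_convergence (μ := volume)
    (a := 0) (b := Real.pi / 2)
    (F := fun (k : ℕ) u => Real.sin ((2 * k + 1) * u) / (2 * k + 1 : ℝ) ^ 3 / Real.sin u)
    (f := fun u => Real.pi / 8 * (u * (Real.pi - u)) / Real.sin u)
    (fun k _ => 1 / ((2 * k + 1 : ℕ) : ℝ) ^ 2) ?_ ?_ ?_ ?_ ?_
  · have h2 : ∀ k : ℕ, ∫ u in (0 : ℝ)..(Real.pi / 2),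
        Real.sin ((2 * k + 1) * u) / (2 * k + 1 : ℝ) ^ 3 / Real.sin u =
        Real.pi / 2 * (1 / (2 * k + 1 : ℝ) ^ 3) := by
      intro k
      refine Eq.trans ?_ (congrArg (· * (1 / (2 * k + 1 : ℝ) ^ 3)) (integral_sin_odd_div_sin k).2)
      rw [← intervalIntegral.integral_mul_const]
      refine intervalIntegral.integral_congr fun u _ => ?_
      ring
    simp only [h2] at h
    have h3 := h.unique (hasSum_one_div_odd_cube.mul_left (Real.pi / 2))
    have h4 : ∫ u in (0 : ℝ)..(Real.pi / 2), Real.pi / 8 * (u * (Real.pi - u)) / Real.sin u =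
        Real.pi / 8 * ∫ u in (0 : ℝ)..(Real.pi / 2), u * (Real.pi - u) / Real.sin u := by
      rw [← intervalIntegral.integral_const_mul]
      congr 1
      ext u
      ring
    rw [h4] at h3
    field_simp at h3 ⊢
    linarith
  · intro k
    exact Measurable.aestronglyMeasurable (by fun_prop)
  · intro k
    refine Filter.Eventually.of_forall fun u _ => ?_
    have h1 := abs_sin_nat_mul_le (2 * k + 1) u
    have hk : (0 : ℝ) < 2 * k + 1 := by positivity
    push_cast at h1 ⊢
    rw [Real.norm_eq_abs, abs_div, abs_div, abs_of_pos (pow_pos hk 3)]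
    rcases (abs_nonneg (Real.sin u)).eq_or_lt' with h0 | h0
    · rw [h0, div_zero]; positivity
    · rw [div_div, div_le_div_iff₀ (by positivity) (by positivity)]
      calc _ ≤ (2 * k + 1) * |Real.sin u| * (2 * k + 1 : ℝ) ^ 2 := by gcongr
        _ = _ := by ring
  · exact Filter.Eventually.of_forall fun u _ => hs2
  · exact intervalIntegrable_const
  · refine Filter.Eventually.of_forall fun u hu => ?_
    rw [Set.uIoc_of_le (by positivity)] at hu
    exact (hasSum_sin_odd_div_cube hu.1.le (by linarith [hu.2])).div_const _

theorem integral_sq_sub_sq_div_cos :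
    ∫ φ in (0 : ℝ)..(Real.pi / 2), (Real.pi ^ 2 / 4 - φ ^ 2) / Real.cos φ =
      7 / 2 * ∑' n : ℕ, 1 / (n : ℝ) ^ 3 := by
  rw [← integral_mul_pi_sub_div_sin]
  have := intervalIntegral.integral_comp_sub_left (a := 0) (b := Real.pi / 2)
    (fun u => u * (Real.pi - u) / Real.sin u) (Real.pi / 2)
  rw [sub_self, sub_zero] at this
  rw [← this]
  congr 1
  ext u
  rw [Real.sin_pi_div_two_sub]
  ring

theorem intervalIntegrable_of_norm_le {f : ℝ → ℝ} (hf : Measurable f) {a b M : ℝ} (hab : a ≤ b)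
    (h : ∀ x ∈ Set.Ioo a b, ‖f x‖ ≤ M) : IntervalIntegrable f volume a b := by
  rw [intervalIntegrable_iff_integrableOn_Ioo_of_le hab]
  refine Measure.integrableOn_of_bounded (by simp) hf.aestronglyMeasurable (M := M) ?_
  filter_upwards [ae_restrict_mem measurableSet_Ioo] with x hx using h x hx

theorem two_div_pi_mul_le_cos {φ : ℝ} (h0 : 0 ≤ φ) (h1 : φ ≤ Real.pi / 2) :
    2 / Real.pi * (Real.pi / 2 - φ) ≤ Real.cos φ := by
  rw [← Real.sin_pi_div_two_sub]
  exact Real.mul_le_sin (by linarith) (by linarith)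

theorem intervalIntegrable_sq_sub_sq_div_cos :
    IntervalIntegrable (fun φ => (Real.pi ^ 2 / 4 - φ ^ 2) / Real.cos φ) volume 0 (Real.pi / 2) := by
  have hpi := Real.pi_pos
  refine intervalIntegrable_of_norm_le (by fun_prop) (by positivity) (M := Real.pi ^ 2 / 2) ?_
  rintro φ ⟨h0, h1⟩
  have hc : 0 < Real.cos φ := Real.cos_pos_of_mem_Ioo ⟨by linarith, h1⟩
  have hle := two_div_pi_mul_le_cos h0.le h1.le
  have hn : 0 ≤ Real.pi ^ 2 / 4 - φ ^ 2 := by nlinarith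
  rw [Real.norm_of_nonneg (div_nonneg hn hc.le), div_le_iff₀ hc]
  calc Real.pi ^ 2 / 4 - φ ^ 2 = (Real.pi / 2 + φ) * (Real.pi / 2 - φ) := by ring
    _ ≤ Real.pi * (Real.pi / 2 - φ) :=
      mul_le_mul_of_nonneg_right (by linarith) (by linarith)
    _ = Real.pi ^ 2 / 2 * (2 / Real.pi * (Real.pi / 2 - φ)) := by field_simp
    _ ≤ _ := by gcongr

theorem intervalIntegrable_pi_div_two_sub_mul_sin_div_cos :
    IntervalIntegrable (fun φ => (Real.pi / 2 - φ * Real.sin φ) / Real.cos φ) volume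
      0 (Real.pi / 2) := by
  have hpi := Real.pi_pos
  refine intervalIntegrable_of_norm_le (by fun_prop) (by positivity) (M := Real.pi) ?_
  rintro φ ⟨h0, h1⟩
  have hc : 0 < Real.cos φ := Real.cos_pos_of_mem_Ioo ⟨by linarith, h1⟩
  have hs : 0 < Real.sin φ := Real.sin_pos_of_pos_of_lt_pi h0 (by linarith)
  have hle := two_div_pi_mul_le_cos h0.le h1.le
  have hs1 := Real.sin_le_one φ
  have hn : 0 ≤ Real.pi / 2 - φ * Real.sin φ := by nlinarith
  -- The numerator is `(π/2 - φ) + φ (1 - sin φ)`, and each part is at most `π/2 · cos φ`.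
  have hsc : 1 - Real.sin φ ≤ Real.cos φ := by
    nlinarith [Real.sin_sq_add_cos_sq φ, mul_pos hs hc]
  rw [Real.norm_of_nonneg (div_nonneg hn hc.le), div_le_iff₀ hc]
  have h2 : Real.pi / 2 - φ ≤ Real.pi / 2 * Real.cos φ := by
    calc Real.pi / 2 - φ = Real.pi / 2 * (2 / Real.pi * (Real.pi / 2 - φ)) := by field_simp
      _ ≤ _ := by gcongr
  have h3 : φ * (1 - Real.sin φ) ≤ Real.pi / 2 * Real.cos φ := by gcongr
  linarith

/-- Adding `log cos φ` makes the integrand an exact derivative, with boundary contribution `π/2 ·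
log 2`; the known integral of `log cos φ`, namely `-π/2 · log 2`, supplies the other half. -/
theorem integral_pi_div_two_sub_mul_sin_div_cos :
    ∫ φ in (0 : ℝ)..(Real.pi / 2), (Real.pi / 2 - φ * Real.sin φ) / Real.cos φ =
      Real.pi * Real.log 2 := by
  have hpi := Real.pi_pos
  have hlog : IntervalIntegrable (fun φ => Real.log (Real.cos φ)) volume 0 (Real.pi / 2) :=
    intervalIntegrable_log_cos
  have hG := integral_eq_sub_of_hasDerivAt_of_le
    (f := fun φ => (φ - Real.pi / 2) * Real.log (Real.cos φ)
      + Real.pi / 2 * Real.log (1 + Real.sin φ))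
    (f' := fun φ => (Real.pi / 2 - φ * Real.sin φ) / Real.cos φ + Real.log (Real.cos φ))
    (a := 0) (b := Real.pi / 2) (by positivity) ?_ ?_
    (intervalIntegrable_pi_div_two_sub_mul_sin_div_cos.add hlog)
  · rw [intervalIntegral.integral_add intervalIntegrable_pi_div_two_sub_mul_sin_div_cos hlog] at hG
    have hl : ∫ φ in (0 : ℝ)..(Real.pi / 2), Real.log (Real.cos φ) =
        -Real.log 2 * Real.pi / 2 := by
      rw [← integral_log_sin_zero_pi_div_two]
      have := intervalIntegral.integral_comp_sub_left (a := 0) (b := Real.pi / 2)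
        (fun u => Real.log (Real.sin u)) (Real.pi / 2)
      rw [sub_self, sub_zero] at this
      rw [← this]
      simp only [Real.sin_pi_div_two_sub]
    rw [hl] at hG
    norm_num at hG
    linarith
  -- Continuity at `π/2`: as `cos φ / (π/2 - φ)` is `sinc (π/2 - φ)`, the singular product becomes
  -- `t log t` at `t = cos φ` over a nonvanishing function.
  · have heq : Set.EqOn (fun φ => -((Real.sinc (Real.pi / 2 - φ))⁻¹ *
        (Real.cos φ * Real.log (Real.cos φ))) + Real.pi / 2 * Real.log (1 + Real.sin φ))
        (fun φ => (φ - Real.pi / 2) * Real.log (Real.cos φ)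
          + Real.pi / 2 * Real.log (1 + Real.sin φ)) (Set.Icc 0 (Real.pi / 2)) := by
      rintro φ ⟨h0, h1⟩
      rcases h1.eq_or_lt with h | h
      · simp [h]
      · have hc : 0 < Real.cos φ := Real.cos_pos_of_mem_Ioo ⟨by linarith, h⟩
        have hne : Real.pi / 2 - φ ≠ 0 := by linarith
        simp only [Real.sinc_of_ne_zero hne, Real.sin_pi_div_two_sub]
        field_simp
        ring
    refine ContinuousOn.congr ?_ heq.symm
    have hml : Continuous fun φ : ℝ => Real.cos φ * Real.log (Real.cos φ) :=
      Real.continuous_mul_log.comp Real.continuous_cos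
    have hsc : Continuous fun φ : ℝ => Real.sinc (Real.pi / 2 - φ) :=
      Real.continuous_sinc.comp (by fun_prop)
    refine ContinuousOn.add (ContinuousOn.neg (ContinuousOn.mul
      (hsc.continuousOn.inv₀ ?_) hml.continuousOn))
      (continuousOn_const.mul (ContinuousOn.log (by fun_prop) ?_))
    · rintro φ ⟨h0, h1⟩
      rcases h1.eq_or_lt with h | h
      · simp [h]
      · rw [Real.sinc_of_ne_zero (by linarith), Real.sin_pi_div_two_sub]
        have hc : 0 < Real.cos φ := Real.cos_pos_of_mem_Ioo ⟨by linarith, h⟩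
        exact (div_pos hc (by linarith)).ne'
    · rintro φ ⟨h0, h1⟩
      have := Real.sin_nonneg_of_nonneg_of_le_pi h0 (by linarith)
      positivity
  · rintro φ ⟨h0, h1⟩
    have hc : 0 < Real.cos φ := Real.cos_pos_of_mem_Ioo ⟨by linarith, h1⟩
    have hs : 0 < Real.sin φ := Real.sin_pos_of_pos_of_lt_pi h0 (by linarith)
    have hs' : (1 + Real.sin φ) ≠ 0 := by positivity
    have hd := (((hasDerivAt_id φ).sub_const (Real.pi / 2)).mul
      ((Real.hasDerivAt_cos φ).log hc.ne')).add
      ((((Real.hasDerivAt_sin φ).const_add 1).log hs').const_mul (Real.pi / 2))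
    refine hd.congr_deriv ?_
    simp only [id]
    have : Real.cos φ / (1 + Real.sin φ) = (1 - Real.sin φ) / Real.cos φ := by
      rw [div_eq_div_iff hs' hc.ne']
      nlinarith [Real.sin_sq_add_cos_sq φ]
    rw [this]
    field_simp
    ring

/-- `∫_0^{π/2} db / (1 + cos φ cos b) = φ / sin φ`. -/
theorem integral_inv_one_add_cos_mul_cos {φ : ℝ} (h0 : 0 < φ) (h1 : φ ≤ Real.pi / 2) :
    ∫ b in (0 : ℝ)..(Real.pi / 2), (1 + Real.cos φ * Real.cos b)⁻¹ = φ / Real.sin φ := by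
  have hpi := Real.pi_pos
  have hs : 0 < Real.sin φ := Real.sin_pos_of_pos_of_lt_pi h0 (by linarith)
  have hc : 0 ≤ Real.cos φ := Real.cos_nonneg_of_mem_Icc ⟨by linarith, h1⟩
  have hcb : ∀ b ∈ Set.uIcc 0 (Real.pi / 2), 0 ≤ Real.cos b := by
    intro b hb
    rw [Set.uIcc_of_le (by positivity)] at hb
    exact Real.cos_nonneg_of_mem_Icc ⟨by linarith [hb.1], hb.2⟩
  -- Half-angle substitution: `sin b / (1 + cos b) = tan (b/2)`, and likewise the factor in `φ` is
  -- `tan (φ/2)`.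
  rw [integral_eq_sub_of_hasDerivAt (f := fun b => 2 / Real.sin φ * Real.arctan
    (Real.sin φ / (1 + Real.cos φ) * (Real.sin b / (1 + Real.cos b))))]
  · have : Real.sin φ / (1 + Real.cos φ) = Real.tan (φ / 2) := by
      have hh : φ = 2 * (φ / 2) := by ring
      have hc2 : 0 < Real.cos (φ / 2) := Real.cos_pos_of_mem_Ioo ⟨by linarith, by linarith⟩
      rw [Real.tan_eq_sin_div_cos]
      conv_lhs => rw [hh, Real.sin_two_mul, Real.cos_two_mul]
      have h3 : 1 + (2 * Real.cos (φ / 2) ^ 2 - 1) = 2 * Real.cos (φ / 2) ^ 2 := by ring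
      rw [h3]
      field_simp
    simp only [Real.sin_pi_div_two, Real.cos_pi_div_two, Real.sin_zero, Real.cos_zero, this]
    norm_num
    rw [Real.arctan_tan (by linarith) (by linarith)]
    field_simp
  · intro b hb
    have hb' := hcb b hb
    have hne : 1 + Real.cos b ≠ 0 := by positivity
    have h2 : 1 + Real.cos φ ≠ 0 := by positivity
    have hd := (((Real.hasDerivAt_sin b).div ((Real.hasDerivAt_cos b).const_add 1) hne).const_mul
      (Real.sin φ / (1 + Real.cos φ))).arctan.const_mul (2 / Real.sin φ)
    refine hd.congr_deriv ?_
    have e1 : Real.cos b * (1 + Real.cos b) - Real.sin b * -Real.sin b = 1 + Real.cos b := by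
      nlinarith [Real.sin_sq_add_cos_sq b]
    simp only [Pi.div_apply]
    rw [e1, mul_pow, div_pow, div_pow, Real.sin_sq φ, Real.sin_sq b]
    have e2 : 1 + (1 - Real.cos φ ^ 2) / (1 + Real.cos φ) ^ 2 *
        ((1 - Real.cos b ^ 2) / (1 + Real.cos b) ^ 2) =
        2 * (1 + Real.cos φ * Real.cos b) / ((1 + Real.cos φ) * (1 + Real.cos b)) := by
      field_simp
      ring
    rw [e2]
    have : 1 + Real.cos φ * Real.cos b ≠ 0 := by positivity
    field_simp
  · refine ContinuousOn.intervalIntegrable (ContinuousOn.inv₀ (by fun_prop) ?_)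
    intro b hb
    have := hcb b hb
    positivity

/-- The integrand is `φ tan φ (1 - 1 / (1 + cos φ cos b))`. The value is grouped so that both terms
stay bounded as `φ → π/2`. -/
theorem integral_cos_div_one_add_cos_mul_cos {φ : ℝ} (h0 : 0 < φ) (h1 : φ < Real.pi / 2) :
    ∫ b in (0 : ℝ)..(Real.pi / 2),
      φ * Real.sin φ * Real.cos b / (1 + Real.cos φ * Real.cos b) =
      (Real.pi ^ 2 / 4 - φ ^ 2) / Real.cos φ -
        Real.pi / 2 * ((Real.pi / 2 - φ * Real.sin φ) / Real.cos φ) := by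
  have hpi := Real.pi_pos
  have hs : 0 < Real.sin φ := Real.sin_pos_of_pos_of_lt_pi h0 (by linarith)
  have hc : 0 < Real.cos φ := Real.cos_pos_of_mem_Ioo ⟨by linarith, h1⟩
  have hcb : ∀ b ∈ Set.uIcc 0 (Real.pi / 2), 0 < 1 + Real.cos φ * Real.cos b := by
    intro b hb
    rw [Set.uIcc_of_le (by positivity)] at hb
    have := Real.cos_nonneg_of_mem_Icc (x := b) ⟨by linarith [hb.1], hb.2⟩
    positivity
  have h : ∫ b in (0 : ℝ)..(Real.pi / 2),
      φ * Real.sin φ * Real.cos b / (1 + Real.cos φ * Real.cos b) =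
      ∫ b in (0 : ℝ)..(Real.pi / 2), φ * Real.sin φ / Real.cos φ *
        (1 - (1 + Real.cos φ * Real.cos b)⁻¹) := by
    refine intervalIntegral.integral_congr fun b hb => ?_
    have h1 : 1 - (1 + Real.cos φ * Real.cos b)⁻¹ =
        Real.cos φ * Real.cos b / (1 + Real.cos φ * Real.cos b) := by
      rw [eq_div_iff (hcb b hb).ne', sub_mul, inv_mul_cancel₀ (hcb b hb).ne']
      ring
    simp only [h1]
    field_simp
  have hi : IntervalIntegrable (fun b => (1 + Real.cos φ * Real.cos b)⁻¹) volume
      0 (Real.pi / 2) :=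
    ContinuousOn.intervalIntegrable (ContinuousOn.inv₀ (by fun_prop) fun b hb => (hcb b hb).ne')
  rw [h, intervalIntegral.integral_const_mul, intervalIntegral.integral_sub (by simp) hi,
    integral_inv_one_add_cos_mul_cos h0 h1.le]
  simp
  field_simp
  ring

/-- Integration by parts against `φ`; the boundary term vanishes at `0` through `φ` and at `π/2`
through `log 1`. -/
theorem integral_log_one_add_cos_mul_cos {b : ℝ} (h0 : 0 ≤ b) (h1 : b ≤ Real.pi / 2) :
    ∫ φ in (0 : ℝ)..(Real.pi / 2), Real.log (1 + Real.cos φ * Real.cos b) =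
    ∫ φ in (0 : ℝ)..(Real.pi / 2),
      φ * Real.sin φ * Real.cos b / (1 + Real.cos φ * Real.cos b) := by
  have hpi := Real.pi_pos
  have hb : 0 ≤ Real.cos b := Real.cos_nonneg_of_mem_Icc ⟨by linarith, h1⟩
  have hpos : ∀ φ ∈ Set.uIcc 0 (Real.pi / 2), 1 + Real.cos φ * Real.cos b ≠ 0 := by
    intro φ hφ
    rw [Set.uIcc_of_le (by positivity)] at hφ
    have := Real.cos_nonneg_of_mem_Icc (x := φ) ⟨by linarith [hφ.1], hφ.2⟩
    positivity
  have hi1 : IntervalIntegrable (fun φ => Real.log (1 + Real.cos φ * Real.cos b)) volume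
      0 (Real.pi / 2) :=
    ContinuousOn.intervalIntegrable (ContinuousOn.log (by fun_prop) hpos)
  have hi2 : IntervalIntegrable (fun φ => φ * Real.sin φ * Real.cos b /
      (1 + Real.cos φ * Real.cos b)) volume 0 (Real.pi / 2) :=
    ContinuousOn.intervalIntegrable (ContinuousOn.div (by fun_prop) (by fun_prop) hpos)
  rw [← sub_eq_zero, ← intervalIntegral.integral_sub hi1 hi2,
    integral_eq_sub_of_hasDerivAt (f := fun φ => φ * Real.log (1 + Real.cos φ * Real.cos b))
      _ (hi1.sub hi2)]
  · simp
  · intro φ hφ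
    refine ((hasDerivAt_id φ).mul
      ((((Real.hasDerivAt_cos φ).mul_const (Real.cos b)).const_add 1).log (hpos φ hφ))).congr_deriv ?_
    simp only [id]
    ring

/-- `∫_0^{π/2} ∫_0^{π/2} log (1 + cos φ cos b) dφ db = 7 ζ(3) / 2 - π² log 2 / 2`. -/
theorem integral_integral_log_one_add_cos_mul_cos :
    ∫ b in (0 : ℝ)..(Real.pi / 2), ∫ φ in (0 : ℝ)..(Real.pi / 2),
      Real.log (1 + Real.cos φ * Real.cos b) =
      7 / 2 * (∑' n : ℕ, 1 / (n : ℝ) ^ 3) - Real.pi ^ 2 / 2 * Real.log 2 := by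
  have hpi := Real.pi_pos
  have hle : (0 : ℝ) ≤ Real.pi / 2 := by positivity
  have h1 : ∫ b in (0 : ℝ)..(Real.pi / 2), ∫ φ in (0 : ℝ)..(Real.pi / 2),
      Real.log (1 + Real.cos φ * Real.cos b) =
      ∫ b in (0 : ℝ)..(Real.pi / 2), ∫ φ in (0 : ℝ)..(Real.pi / 2),
      φ * Real.sin φ * Real.cos b / (1 + Real.cos φ * Real.cos b) := by
    refine intervalIntegral.integral_congr fun b hb => ?_
    rw [Set.uIcc_of_le hle] at hb
    exact integral_log_one_add_cos_mul_cos hb.1 hb.2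
  have hint : Integrable (Function.uncurry fun b φ : ℝ =>
      φ * Real.sin φ * Real.cos b / (1 + Real.cos φ * Real.cos b))
      ((volume.restrict (Set.Ioc 0 (Real.pi / 2))).prod
        (volume.restrict (Set.Ioc 0 (Real.pi / 2)))) := by
    rw [Measure.prod_restrict]
    refine IntegrableOn.mono_set (t := Set.Icc 0 (Real.pi / 2) ×ˢ Set.Icc 0 (Real.pi / 2)) ?_
      (Set.prod_mono Set.Ioc_subset_Icc_self Set.Ioc_subset_Icc_self)
    refine ContinuousOn.integrableOn_compact (isCompact_Icc.prod isCompact_Icc) ?_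
    refine ContinuousOn.div (by fun_prop) (by fun_prop) ?_
    rintro ⟨b, φ⟩ ⟨hb, hφ⟩
    have e1 := Real.cos_nonneg_of_mem_Icc (x := φ) ⟨by linarith [hφ.1], hφ.2⟩
    have e2 := Real.cos_nonneg_of_mem_Icc (x := b) ⟨by linarith [hb.1], hb.2⟩
    simp only
    positivity
  have h2 : ∫ b in (0 : ℝ)..(Real.pi / 2), ∫ φ in (0 : ℝ)..(Real.pi / 2),
      φ * Real.sin φ * Real.cos b / (1 + Real.cos φ * Real.cos b) =
      ∫ φ in (0 : ℝ)..(Real.pi / 2), ∫ b in (0 : ℝ)..(Real.pi / 2),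
      φ * Real.sin φ * Real.cos b / (1 + Real.cos φ * Real.cos b) := by
    simp only [intervalIntegral.integral_of_le hle]
    exact integral_integral_swap hint
  have h3 : ∫ φ in (0 : ℝ)..(Real.pi / 2), ∫ b in (0 : ℝ)..(Real.pi / 2),
      φ * Real.sin φ * Real.cos b / (1 + Real.cos φ * Real.cos b) =
      ∫ φ in (0 : ℝ)..(Real.pi / 2), ((Real.pi ^ 2 / 4 - φ ^ 2) / Real.cos φ -
        Real.pi / 2 * ((Real.pi / 2 - φ * Real.sin φ) / Real.cos φ)) := by
    rw [intervalIntegral.integral_of_le hle, intervalIntegral.integral_of_le hle,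
      integral_Ioc_eq_integral_Ioo, integral_Ioc_eq_integral_Ioo]
    exact setIntegral_congr_fun measurableSet_Ioo
      fun φ hφ => integral_cos_div_one_add_cos_mul_cos hφ.1 hφ.2
  rw [h1, h2, h3, intervalIntegral.integral_sub intervalIntegrable_sq_sub_sq_div_cos
    (intervalIntegrable_pi_div_two_sub_mul_sin_div_cos.const_mul _),
    intervalIntegral.integral_const_mul, integral_sq_sub_sq_div_cos,
    integral_pi_div_two_sub_mul_sin_div_cos]
  ring

/-! ### Jensen's formula and the Mahler measures of `P` and `Q`. -/

/-- Jensen's formula for an affine polynomial, as an integral over `[0, 1]`. -/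
theorem integral_log_norm_add_mul_exp (a : ℂ) {b : ℂ} (hb : b ≠ 0) :
    IntervalIntegrable (fun t : ℝ =>
      Real.log ‖a + b * Complex.exp (2 * (Real.pi : ℂ) * Complex.I * (t : ℂ))‖) volume 0 1 ∧
    ∫ t in (0 : ℝ)..1, Real.log ‖a + b * Complex.exp (2 * (Real.pi : ℂ) * Complex.I * (t : ℂ))‖ =
      Real.log ‖b‖ + Real.posLog (‖a‖ / ‖b‖) := by
  have hpi := Real.pi_pos
  set p : Polynomial ℂ := Polynomial.C b * Polynomial.X + Polynomial.C a with hp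
  have hfun : ∀ t : ℝ, Real.log ‖a + b * Complex.exp (2 * (Real.pi : ℂ) * Complex.I * (t : ℂ))‖ =
      (fun x : ℝ => Real.log ‖p.eval (circleMap 0 1 x)‖) (2 * Real.pi * t) := by
    intro t
    simp only [hp, circleMap, Polynomial.eval_add, Polynomial.eval_mul, Polynomial.eval_C,
      Polynomial.eval_X]
    congr 2
    push_cast
    rw [add_comm, zero_add, one_mul]
    congr 3
    ring
  simp only [hfun]
  constructor
  · have h := p.intervalIntegrable_mahlerMeasure.comp_mul_left (c := 2 * Real.pi)
    rwa [zero_div, div_self (by positivity)] at h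
  · have h := p.logMahlerMeasure_def
    rw [hp, Polynomial.logMahlerMeasure_C_mul_X_add_C hb, ← hp, Real.circleAverage_def] at h
    rw [intervalIntegral.integral_comp_mul_left
      (fun x => Real.log ‖p.eval (circleMap 0 1 x)‖) (by positivity), mul_zero, mul_one, ← h,
      norm_mul, norm_inv, div_eq_inv_mul]

theorem log_norm_add_mul_exp_le {a b : ℂ} (ha : ‖a‖ ≤ 3) (hb : ‖b‖ = 2) (t : ℝ) :
    Real.posLog ‖a + b * Complex.exp (2 * (Real.pi : ℂ) * Complex.I * (t : ℂ))‖ ≤ Real.log 5 := by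
  have he : ‖Complex.exp (2 * (Real.pi : ℂ) * Complex.I * (t : ℂ))‖ = 1 := by
    have : 2 * (Real.pi : ℂ) * Complex.I * (t : ℂ) = ((2 * Real.pi * t : ℝ) : ℂ) * Complex.I := by
      push_cast; ring
    rw [this, Complex.norm_exp_ofReal_mul_I]
  have h1 : ‖a + b * Complex.exp (2 * (Real.pi : ℂ) * Complex.I * (t : ℂ))‖ ≤ 5 := by
    refine (norm_add_le _ _).trans ?_
    rw [norm_mul, he, hb]
    linarith
  refine (Real.posLog_le_posLog (norm_nonneg _) h1).trans (le_of_eq ?_)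
  exact Real.posLog_eq_log (by norm_num)

/-- If `u ≤ log 5` then `|u| ≤ 2 log 5 - u`, and by Jensen the mean of `u` is nonnegative.
Uniformity in `a`, `b` is what Tonelli needs. -/
theorem integral_norm_log_norm_add_mul_exp_le {a b : ℂ} (ha : ‖a‖ ≤ 3) (hb : ‖b‖ = 2) :
    ∫ t in (0 : ℝ)..1,
      ‖Real.log ‖a + b * Complex.exp (2 * (Real.pi : ℂ) * Complex.I * (t : ℂ))‖‖ ≤
      2 * Real.log 5 := by
  have hb0 : b ≠ 0 := by rintro rfl; simp at hb
  obtain ⟨h1, h2⟩ := integral_log_norm_add_mul_exp a hb0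
  have h3 : ∫ t in (0 : ℝ)..1,
      ‖Real.log ‖a + b * Complex.exp (2 * (Real.pi : ℂ) * Complex.I * (t : ℂ))‖‖ ≤
      ∫ t in (0 : ℝ)..1, (2 * Real.log 5 -
        Real.log ‖a + b * Complex.exp (2 * (Real.pi : ℂ) * Complex.I * (t : ℂ))‖) := by
    refine intervalIntegral.integral_mono_on zero_le_one h1.norm (intervalIntegrable_const.sub h1) ?_
    intro t _
    have h := log_norm_add_mul_exp_le ha hb t
    have h0 := Real.posLog_nonneg
      (x := ‖a + b * Complex.exp (2 * (Real.pi : ℂ) * Complex.I * (t : ℂ))‖)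
    have hl : Real.log ‖a + b * Complex.exp (2 * (Real.pi : ℂ) * Complex.I * (t : ℂ))‖ ≤
      Real.posLog ‖a + b * Complex.exp (2 * (Real.pi : ℂ) * Complex.I * (t : ℂ))‖ := le_max_right _ _
    rw [Real.norm_eq_abs, abs_le]
    constructor <;> linarith
  rw [intervalIntegral.integral_sub intervalIntegrable_const h1, h2] at h3
  have h4 : 0 ≤ Real.log ‖b‖ := by rw [hb]; exact Real.log_nonneg (by norm_num)
  have h5 := Real.posLog_nonneg (x := ‖a‖ / ‖b‖)
  simp only [intervalIntegral.integral_const, sub_zero, one_smul] at h3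
  linarith

theorem integral_comp_sin_two_pi_mul {F : ℝ → ℝ} (hF : Continuous F) :
    ∫ t in (0 : ℝ)..1, F (Real.sin (2 * Real.pi * t)) =
      Real.pi⁻¹ * ∫ u in (0 : ℝ)..(Real.pi / 2), (F (Real.cos u) + F (-Real.cos u)) := by
  have hpi := Real.pi_pos
  have hi : ∀ a b : ℝ, IntervalIntegrable (fun x => F (Real.cos x)) volume a b :=
    fun a b => (hF.comp Real.continuous_cos).intervalIntegrable _ _
  have h1 : ∫ t in (0 : ℝ)..1, F (Real.sin (2 * Real.pi * t)) =
      (2 * Real.pi)⁻¹ * ∫ x in (-(Real.pi / 2))..(-(Real.pi / 2) + 2 * Real.pi), F (Real.cos x) := by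
    rw [intervalIntegral.integral_comp_mul_left (fun x => F (Real.sin x)) (by positivity), mul_zero,
      mul_one, smul_eq_mul]
    have h := intervalIntegral.integral_comp_sub_right (a := 0) (b := 2 * Real.pi)
      (fun x => F (Real.cos x)) (Real.pi / 2)
    simp only [Real.cos_sub_pi_div_two] at h
    rw [h]
    congr 2 <;> ring
  have h2 : ∫ x in (-(Real.pi / 2))..(-(Real.pi / 2) + 2 * Real.pi), F (Real.cos x) =
      (∫ x in (-(Real.pi / 2))..(Real.pi / 2), F (Real.cos x)) +
      ∫ x in (-(Real.pi / 2))..(Real.pi / 2), F (-Real.cos x) := by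
    rw [← intervalIntegral.integral_add_adjacent_intervals (hi _ (Real.pi / 2)) (hi _ _)]
    congr 1
    have h := intervalIntegral.integral_comp_add_right (a := -(Real.pi / 2)) (b := Real.pi / 2)
      (fun x => F (Real.cos x)) Real.pi
    simp only [Real.cos_add_pi] at h
    rw [h]
    congr 1 <;> ring
  have h3 : ∀ G : ℝ → ℝ, Continuous G → ∫ x in (-(Real.pi / 2))..(Real.pi / 2), G (Real.cos x) =
      2 * ∫ x in (0 : ℝ)..(Real.pi / 2), G (Real.cos x) := by
    intro G hG
    have hi : ∀ a b : ℝ, IntervalIntegrable (fun x => G (Real.cos x)) volume a b :=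
      fun a b => (hG.comp Real.continuous_cos).intervalIntegrable _ _
    rw [← intervalIntegral.integral_add_adjacent_intervals (hi _ 0) (hi _ _)]
    have h := intervalIntegral.integral_comp_neg (a := 0) (b := Real.pi / 2)
      (fun x => G (Real.cos x))
    simp only [Real.cos_neg, neg_zero] at h
    rw [← h]
    ring
  have hneg : Continuous fun x => F (-x) := by fun_prop
  have hi' : IntervalIntegrable (fun x => F (-Real.cos x)) volume 0 (Real.pi / 2) :=
    (hneg.comp Real.continuous_cos).intervalIntegrable _ _
  rw [h1, h2, h3 F hF, h3 (fun x => F (-x)) hneg, intervalIntegral.integral_add (hi _ _) hi']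
  field_simp

/-- Folding pairs the signs `±`, so `ε` is immaterial; with `0 ≤ cos b cos u ≤ 1` only the plus sign
contributes, and there `log⁺` is `log`. Each folding brings `1/π`, and evenness of the inner average
gives the 2. -/
theorem integral_integral_posLog {ε : ℝ} (hε : ε = 1 ∨ ε = -1) :
    ∫ s in (0 : ℝ)..1, ∫ t in (0 : ℝ)..1,
      Real.posLog (1 + ε * (Real.sin (2 * Real.pi * s) * Real.sin (2 * Real.pi * t))) =
      2 / Real.pi ^ 2 * (7 / 2 * (∑' n : ℕ, 1 / (n : ℝ) ^ 3) - Real.pi ^ 2 / 2 * Real.log 2) := by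
  have hpi := Real.pi_pos
  set K : ℝ → ℝ := fun c => Real.pi⁻¹ * ∫ u in (0 : ℝ)..(Real.pi / 2),
    (Real.posLog (1 + c * Real.cos u) + Real.posLog (1 + c * -Real.cos u)) with hK
  have hKc : Continuous K := by
    refine continuous_const.mul
      (intervalIntegral.continuous_parametric_intervalIntegral_of_continuous' ?_ _ _)
    unfold Function.uncurry
    fun_prop
  have hKneg : ∀ c, K (-c) = K c := by
    intro c
    simp only [hK]
    congr 1
    refine intervalIntegral.integral_congr fun u _ => ?_
    simp only [neg_mul, mul_neg]
    ring_nf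
  have hKε : ∀ c, K (ε * c) = K c := by
    intro c
    rcases hε with rfl | rfl
    · rw [one_mul]
    · rw [neg_one_mul, hKneg]
  have h1 : ∀ s : ℝ, ∫ t in (0 : ℝ)..1,
      Real.posLog (1 + ε * (Real.sin (2 * Real.pi * s) * Real.sin (2 * Real.pi * t))) =
      K (Real.sin (2 * Real.pi * s)) := by
    intro s
    rw [← hKε]
    simp only [← mul_assoc]
    exact integral_comp_sin_two_pi_mul
      (F := fun x => Real.posLog (1 + ε * Real.sin (2 * Real.pi * s) * x)) (by fun_prop)
  simp only [h1]
  rw [integral_comp_sin_two_pi_mul hKc, ← integral_integral_log_one_add_cos_mul_cos]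
  simp only [hKneg]
  rw [← intervalIntegral.integral_const_mul, ← intervalIntegral.integral_const_mul]
  refine intervalIntegral.integral_congr fun b hb => ?_
  rw [Set.uIcc_of_le (by positivity)] at hb
  have e1 := Real.cos_nonneg_of_mem_Icc (x := b) ⟨by linarith [hb.1], hb.2⟩
  have h2 : ∫ u in (0 : ℝ)..(Real.pi / 2),
      (Real.posLog (1 + Real.cos b * Real.cos u) + Real.posLog (1 + Real.cos b * -Real.cos u)) =
      ∫ φ in (0 : ℝ)..(Real.pi / 2), Real.log (1 + Real.cos φ * Real.cos b) := by
    refine intervalIntegral.integral_congr fun φ hφ => ?_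
    rw [Set.uIcc_of_le (by positivity)] at hφ
    have e2 := Real.cos_nonneg_of_mem_Icc (x := φ) ⟨by linarith [hφ.1], hφ.2⟩
    have e3 := Real.cos_le_one b
    have e4 := Real.cos_le_one φ
    have e5 : Real.cos b * Real.cos φ ≤ 1 := mul_le_one₀ e3 e2 e4
    have e6 : 0 ≤ Real.cos b * Real.cos φ := mul_nonneg e1 e2
    rw [Real.posLog_eq_log (by rw [abs_of_nonneg] <;> linarith),
      (Real.posLog_eq_zero_iff _).mpr (by rw [abs_of_nonneg] <;> linarith), add_zero,
      mul_comm (Real.cos b)]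
  simp only [hK, h2]
  ring

/-- Splits off the coordinate 1, the angle of `y`, so that Jensen's formula applies to the innermost
integral. -/
theorem integral_Icc_fin_three {f : ℝ → ℝ → ℝ → ℝ}
    (hf : IntegrableOn (fun p : ℝ × (Fin 2 → ℝ) => f p.1 (p.2 0) (p.2 1))
      (Set.Icc (0 : ℝ) 1 ×ˢ Set.Icc (0 : Fin 2 → ℝ) 1) (volume.prod volume)) :
    IntegrableOn (fun θ : Fin 3 → ℝ => f (θ 1) (θ 0) (θ 2)) (Set.Icc 0 1) ∧
    ∫ θ in Set.Icc (0 : Fin 3 → ℝ) 1, f (θ 1) (θ 0) (θ 2) =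
      ∫ p in Set.Icc (0 : Fin 2 → ℝ) 1, ∫ x in Set.Icc (0 : ℝ) 1, f x (p 0) (p 1) := by
  have hmp := volume_preserving_piFinSuccAbove (fun _ : Fin 3 => ℝ) 1
  have hset : (Set.Icc 0 1 : Set (Fin 3 → ℝ)) =
      MeasurableEquiv.piFinSuccAbove (fun _ : Fin 3 => ℝ) 1 ⁻¹'
        (Set.Icc (0 : ℝ) 1 ×ˢ Set.Icc (0 : Fin 2 → ℝ) 1) := by
    ext θ
    have e1 : (MeasurableEquiv.piFinSuccAbove (fun _ : Fin 3 => ℝ) 1 θ).1 = θ 1 := rfl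
    have e2 : (MeasurableEquiv.piFinSuccAbove (fun _ : Fin 3 => ℝ) 1 θ).2 0 = θ 0 := rfl
    have e3 : (MeasurableEquiv.piFinSuccAbove (fun _ : Fin 3 => ℝ) 1 θ).2 1 = θ 2 := rfl
    simp only [Set.mem_preimage, Set.mem_prod, Set.mem_Icc, Pi.le_def, Fin.forall_fin_succ,
      Pi.zero_apply, Pi.one_apply, Fin.forall_fin_zero, Fin.succ_zero_eq_one, Fin.succ_one_eq_two,
      Fin.isValue, e1, e2, e3]
    tauto
  constructor
  · rw [hset]
    exact (hmp.integrableOn_comp_preimage (MeasurableEquiv.measurableEmbedding _)).mpr hf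
  · have h1 : ∫ θ in Set.Icc (0 : Fin 3 → ℝ) 1, f (θ 1) (θ 0) (θ 2) =
        ∫ p in Set.Icc (0 : ℝ) 1 ×ˢ Set.Icc (0 : Fin 2 → ℝ) 1, f p.1 (p.2 0) (p.2 1)
          ∂(volume.prod volume) := by
      rw [hset]
      exact hmp.setIntegral_preimage_emb (MeasurableEquiv.measurableEmbedding _)
        (fun p : ℝ × (Fin 2 → ℝ) => f p.1 (p.2 0) (p.2 1)) _
    rw [IntegrableOn, ← Measure.prod_restrict] at hf
    rw [h1, ← Measure.prod_restrict, integral_prod_symm _ hf]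

theorem integral_Icc_fin_two {g : ℝ → ℝ → ℝ} (hg : Continuous (Function.uncurry g)) :
    ∫ p in Set.Icc (0 : Fin 2 → ℝ) 1, g (p 0) (p 1) =
      ∫ s in (0 : ℝ)..1, ∫ t in (0 : ℝ)..1, g s t := by
  have hset : (Set.Icc 0 1 : Set (Fin 2 → ℝ)) =
      MeasurableEquiv.finTwoArrow ⁻¹' (Set.Icc (0 : ℝ) 1 ×ˢ Set.Icc (0 : ℝ) 1) := by
    ext θ
    have e2 : (MeasurableEquiv.finTwoArrow θ).1 = θ 0 := rfl
    have e3 : (MeasurableEquiv.finTwoArrow θ).2 = θ 1 := rfl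
    simp only [Set.mem_preimage, Set.mem_prod, Set.mem_Icc, Pi.le_def, Fin.forall_fin_succ,
      Pi.zero_apply, Pi.one_apply, Fin.forall_fin_zero, Fin.succ_zero_eq_one, Fin.isValue,
      e2, e3]
    tauto
  have h2 : ∫ p in (Set.Icc 0 1 : Set (Fin 2 → ℝ)), g (p 0) (p 1) =
      ∫ q in Set.Icc (0 : ℝ) 1 ×ˢ Set.Icc (0 : ℝ) 1, Function.uncurry g q
        ∂(volume.prod volume) := by
    rw [hset]
    exact (volume_preserving_finTwoArrow ℝ).setIntegral_preimage_emb
      MeasurableEquiv.finTwoArrow.measurableEmbedding (Function.uncurry g) _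
  rw [h2, setIntegral_prod _ (hg.continuousOn.integrableOn_compact
    (isCompact_Icc.prod isCompact_Icc))]
  simp only [integral_Icc_eq_integral_Ioc, ← intervalIntegral.integral_of_le zero_le_one,
    Function.uncurry]

/-- Tonelli: in `y` the logarithm is integrable, with an `L¹` norm bounded uniformly in the other
two angles. -/
theorem integrableOn_log_norm_add_mul_exp {a b : ℝ → ℝ → ℂ} (ha : Continuous (Function.uncurry a))
    (hb : Continuous (Function.uncurry b)) (hb2 : ∀ s t, ‖b s t‖ = 2)
    (ha3 : ∀ s t, ‖a s t‖ ≤ 3) :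
    IntegrableOn (fun p : ℝ × (Fin 2 → ℝ) => Real.log ‖a (p.2 0) (p.2 1) + b (p.2 0) (p.2 1) *
      Complex.exp (2 * (Real.pi : ℂ) * Complex.I * (p.1 : ℂ))‖)
      (Set.Icc (0 : ℝ) 1 ×ˢ Set.Icc (0 : Fin 2 → ℝ) 1) (volume.prod volume) := by
  have hb0 : ∀ s t, b s t ≠ 0 := fun s t h => by simpa [h] using hb2 s t
  have hfm : StronglyMeasurable (fun p : ℝ × (Fin 2 → ℝ) => Real.log ‖a (p.2 0) (p.2 1) +
      b (p.2 0) (p.2 1) * Complex.exp (2 * (Real.pi : ℂ) * Complex.I * (p.1 : ℂ))‖) := by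
    have ha' : Continuous fun p : ℝ × (Fin 2 → ℝ) => a (p.2 0) (p.2 1) :=
      ha.comp (g := Function.uncurry a) (f := fun p : ℝ × (Fin 2 → ℝ) => (p.2 0, p.2 1))
        (by fun_prop)
    have hb' : Continuous fun p : ℝ × (Fin 2 → ℝ) => b (p.2 0) (p.2 1) :=
      hb.comp (g := Function.uncurry b) (f := fun p : ℝ × (Fin 2 → ℝ) => (p.2 0, p.2 1))
        (by fun_prop)
    exact (Real.measurable_log.comp (Continuous.measurable (by fun_prop))).stronglyMeasurable
  rw [IntegrableOn, ← Measure.prod_restrict, integrable_prod_iff' hfm.aestronglyMeasurable]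
  constructor
  · refine Filter.Eventually.of_forall fun p => ?_
    have h := (integral_log_norm_add_mul_exp (a (p 0) (p 1)) (hb0 (p 0) (p 1))).1
    rwa [intervalIntegrable_iff_integrableOn_Icc_of_le zero_le_one] at h
  · refine Measure.integrableOn_of_bounded (M := 2 * Real.log 5) isCompact_Icc.measure_lt_top.ne
      ?_ ?_
    · exact hfm.norm.integral_prod_left'.aestronglyMeasurable
    · refine Filter.Eventually.of_forall fun p => ?_
      have h := integral_norm_log_norm_add_mul_exp_le (ha3 (p 0) (p 1)) (hb2 (p 0) (p 1))
      rw [intervalIntegral.integral_of_le zero_le_one, ← integral_Icc_eq_integral_Ioc] at h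
      rwa [Real.norm_of_nonneg (integral_nonneg fun _ => norm_nonneg _)]

theorem integral_integral_log_two_add_posLog {ε : ℝ} (hε : ε = 1 ∨ ε = -1) :
    ∫ s in (0 : ℝ)..1, ∫ t in (0 : ℝ)..1, (Real.log 2 + 1 / 2 *
      Real.posLog (1 + ε * (Real.sin (2 * Real.pi * s) * Real.sin (2 * Real.pi * t)))) =
      7 / (2 * Real.pi ^ 2) * (∑' n : ℕ, 1 / (n : ℝ) ^ 3) + Real.log 2 / 2 := by
  have hpi := Real.pi_pos
  have h3 : ∀ s : ℝ, ∫ t in (0 : ℝ)..1, (Real.log 2 + 1 / 2 *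
      Real.posLog (1 + ε * (Real.sin (2 * Real.pi * s) * Real.sin (2 * Real.pi * t)))) =
      Real.log 2 + 1 / 2 * ∫ t in (0 : ℝ)..1,
      Real.posLog (1 + ε * (Real.sin (2 * Real.pi * s) * Real.sin (2 * Real.pi * t))) := by
    intro s
    rw [intervalIntegral.integral_add (by simp)
      (Continuous.intervalIntegrable (by fun_prop) _ _), intervalIntegral.integral_const_mul]
    simp
  simp only [h3]
  have hc : Continuous fun s : ℝ => ∫ t in (0 : ℝ)..1,
      Real.posLog (1 + ε * (Real.sin (2 * Real.pi * s) * Real.sin (2 * Real.pi * t))) := by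
    refine intervalIntegral.continuous_parametric_intervalIntegral_of_continuous' ?_ _ _
    unfold Function.uncurry
    fun_prop
  rw [intervalIntegral.integral_add (by simp) ((hc.const_mul _).intervalIntegrable _ _),
    intervalIntegral.integral_const_mul, integral_integral_posLog hε]
  simp only [intervalIntegral.integral_const, sub_zero, one_smul]
  field_simp
  ring

/-- Jensen gives `log 2 + log⁺(‖a‖/2)`; squaring inside `log⁺` doubles it, whence the `1/2`. -/
theorem integral_Icc_log_norm_add_mul_exp {a b : ℂ} (hb : ‖b‖ = 2) {w : ℝ}
    (ha : ‖a‖ ^ 2 = 4 * (1 + w)) :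
    ∫ x in Set.Icc (0 : ℝ) 1,
      Real.log ‖a + b * Complex.exp (2 * (Real.pi : ℂ) * Complex.I * (x : ℂ))‖ =
      Real.log 2 + 1 / 2 * Real.posLog (1 + w) := by
  have hb0 : b ≠ 0 := by rintro rfl; simp at hb
  rw [integral_Icc_eq_integral_Ioc, ← intervalIntegral.integral_of_le zero_le_one,
    (integral_log_norm_add_mul_exp a hb0).2, hb]
  congr 1
  have h := Real.posLog_pow 2 (‖a‖ / 2)
  have h4 : 4 * (1 + w) / 2 ^ 2 = 1 + w := by ring
  rw [div_pow, ha, h4] at h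
  rw [h]
  push_cast
  ring

/-- The Mahler measure of `a + b y` over the cube, where `‖b‖ = 2` and
`‖a‖² = 4 (1 ± sin 2πs sin 2πt)`. -/
theorem integral_log_norm_cube {a b : ℝ → ℝ → ℂ} (ha : Continuous (Function.uncurry a))
    (hb : Continuous (Function.uncurry b)) (hb2 : ∀ s t, ‖b s t‖ = 2) {ε : ℝ}
    (hε : ε = 1 ∨ ε = -1) (ha2 : ∀ s t, ‖a s t‖ ^ 2 =
      4 * (1 + ε * (Real.sin (2 * Real.pi * s) * Real.sin (2 * Real.pi * t))))
    {F : (Fin 3 → ℝ) → ℝ} (hF : ∀ θ, F θ = Real.log ‖a (θ 0) (θ 2) + b (θ 0) (θ 2) *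
      Complex.exp (2 * (Real.pi : ℂ) * Complex.I * (θ 1 : ℂ))‖) :
    IntegrableOn F (Set.Icc 0 1) ∧ ∫ θ in Set.Icc (0 : Fin 3 → ℝ) 1, F θ =
      7 / (2 * Real.pi ^ 2) * (∑' n : ℕ, 1 / (n : ℝ) ^ 3) + Real.log 2 / 2 := by
  -- The squared modulus is at most 8.
  have ha3 : ∀ s t, ‖a s t‖ ≤ 3 := by
    intro s t
    have h1 := abs_le.mp (Real.abs_sin_le_one (2 * Real.pi * s))
    have h2 := abs_le.mp (Real.abs_sin_le_one (2 * Real.pi * t))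
    have h3 : ε * (Real.sin (2 * Real.pi * s) * Real.sin (2 * Real.pi * t)) ≤ 1 := by
      rcases hε with rfl | rfl <;> nlinarith
    nlinarith [ha2 s t, norm_nonneg (a s t)]
  have hFeq : F = fun θ => (fun x s t => Real.log ‖a s t + b s t *
      Complex.exp (2 * (Real.pi : ℂ) * Complex.I * (x : ℂ))‖) (θ 1) (θ 0) (θ 2) := funext hF
  obtain ⟨h1, h2⟩ := integral_Icc_fin_three (f := fun x s t => Real.log ‖a s t + b s t *
    Complex.exp (2 * (Real.pi : ℂ) * Complex.I * (x : ℂ))‖)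
    (integrableOn_log_norm_add_mul_exp ha hb hb2 ha3)
  rw [hFeq]
  refine ⟨h1, h2.trans ?_⟩
  simp only [fun p : Fin 2 → ℝ => integral_Icc_log_norm_add_mul_exp (hb2 (p 0) (p 1))
    (ha2 (p 0) (p 1))]
  rw [← integral_integral_log_two_add_posLog hε]
  refine integral_Icc_fin_two (g := fun s t => Real.log 2 + 1 / 2 *
      Real.posLog (1 + ε * (Real.sin (2 * Real.pi * s) * Real.sin (2 * Real.pi * t)))) ?_
  unfold Function.uncurry
  fun_prop

theorem exp_two_pi_I_mul (t : ℝ) : Complex.exp (2 * (Real.pi : ℂ) * Complex.I * (t : ℂ)) =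
    (Real.cos (2 * Real.pi * t) : ℂ) + (Real.sin (2 * Real.pi * t) : ℂ) * Complex.I := by
  rw [Complex.ofReal_cos, Complex.ofReal_sin, ← Complex.exp_mul_I]
  congr 1
  push_cast
  ring

/-- The square terms add up to `|1 + x|² + |1 - x|² = 4`. The conjugate of `1 - x` times `1 + x` is
`2i sin (arg x)`, so the cross term is `4ε` times the product of sines. -/
theorem norm_sq_one_add_add_mul_one_sub_mul (s t : ℝ) {ε : ℝ} (hε : ε = 1 ∨ ε = -1) :
    ‖1 + Complex.exp (2 * (Real.pi : ℂ) * Complex.I * (s : ℂ)) +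
      ε * ((1 - Complex.exp (2 * (Real.pi : ℂ) * Complex.I * (s : ℂ))) *
        Complex.exp (2 * (Real.pi : ℂ) * Complex.I * (t : ℂ)))‖ ^ 2 =
      4 * (1 + ε * (Real.sin (2 * Real.pi * s) * Real.sin (2 * Real.pi * t))) := by
  rw [exp_two_pi_I_mul, exp_two_pi_I_mul, ← Complex.normSq_eq_norm_sq, Complex.normSq_apply]
  have h1 := Real.sin_sq_add_cos_sq (2 * Real.pi * s)
  have h2 := Real.sin_sq_add_cos_sq (2 * Real.pi * t)
  set c := Real.cos (2 * Real.pi * s)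
  set d := Real.sin (2 * Real.pi * s)
  set c' := Real.cos (2 * Real.pi * t)
  set d' := Real.sin (2 * Real.pi * t)
  simp only [Complex.add_re, Complex.add_im, Complex.mul_re, Complex.mul_im, Complex.sub_re,
    Complex.sub_im, Complex.one_re, Complex.one_im, Complex.ofReal_re, Complex.ofReal_im,
    Complex.I_re, Complex.I_im]
  rcases hε with rfl | rfl
  · linear_combination ((1 - c) ^ 2 + d ^ 2) * h2 + (2 - 2 * c') * h1
  · linear_combination ((1 - c) ^ 2 + d ^ 2) * h2 + (2 + 2 * c') * h1

theorem mahler_polyP : IntegrableOn (mahlerIntegrand polyP) (Set.Icc 0 1) ∧ logMahler polyP =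
    7 / (2 * Real.pi ^ 2) * (∑' n : ℕ, 1 / (n : ℝ) ^ 3) + Real.log 2 / 2 := by
  refine integral_log_norm_cube
    (a := fun s t => 1 + Complex.exp (2 * (Real.pi : ℂ) * Complex.I * (s : ℂ)) +
      (-1 : ℝ) * ((1 - Complex.exp (2 * (Real.pi : ℂ) * Complex.I * (s : ℂ))) *
        Complex.exp (2 * (Real.pi : ℂ) * Complex.I * (t : ℂ))))
    (b := fun s _ => 2 * Complex.exp (2 * (Real.pi : ℂ) * Complex.I * (s : ℂ)))
    (ε := -1) ?_ ?_ ?_ (Or.inr rfl)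
    (fun s t => norm_sq_one_add_add_mul_one_sub_mul s t (Or.inr rfl)) ?_
  · unfold Function.uncurry; fun_prop
  · unfold Function.uncurry; fun_prop
  · intro s _
    have : 2 * (Real.pi : ℂ) * Complex.I * (s : ℂ) = ((2 * Real.pi * s : ℝ) : ℂ) * Complex.I := by
      push_cast; ring
    rw [norm_mul, this, Complex.norm_exp_ofReal_mul_I]
    simp
  · intro θ
    rw [mahlerIntegrand]
    congr 2
    simp [polyP]
    ring

theorem mahler_polyQ : IntegrableOn (mahlerIntegrand polyQ) (Set.Icc 0 1) ∧ logMahler polyQ =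
    7 / (2 * Real.pi ^ 2) * (∑' n : ℕ, 1 / (n : ℝ) ^ 3) + Real.log 2 / 2 := by
  refine integral_log_norm_cube
    (a := fun s t => 1 + Complex.exp (2 * (Real.pi : ℂ) * Complex.I * (s : ℂ)) +
      (1 : ℝ) * ((1 - Complex.exp (2 * (Real.pi : ℂ) * Complex.I * (s : ℂ))) *
        Complex.exp (2 * (Real.pi : ℂ) * Complex.I * (t : ℂ))))
    (b := fun _ _ => 2) (ε := 1) ?_ ?_ ?_ (Or.inl rfl)
    (fun s t => norm_sq_one_add_add_mul_one_sub_mul s t (Or.inl rfl)) ?_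
  · unfold Function.uncurry; fun_prop
  · unfold Function.uncurry; fun_prop
  · intro _ _
    simp
  · intro θ
    rw [mahlerIntegrand]
    congr 2
    simp [polyQ]
    ring

/-! ### Logarithmic derivatives along curves. -/

section
variable {E : Type*} [NormedAddCommGroup E] [NormedSpace ℝ E]

/-- Chain rule: a value of `df / f` on a tangent vector can be read off along any curve with that
velocity, here the coordinate curves. -/
theorem dLogC_apply_of_hasDerivAt {f : E → ℂ} {p v : E} {γ : ℝ → E} {s : ℝ} {d : ℂ}
    (hf : DifferentiableAt ℝ f p) (hγ : HasDerivAt γ v s) (hp : γ s = p)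
    (hd : HasDerivAt (fun r => f (γ r)) d s) : dLogC f p v = (f p)⁻¹ * d := by
  subst hp
  have h := hf.hasFDerivAt.comp_hasDerivAt s hγ
  rw [← h.unique hd]
  rfl

theorem dLogC_const (c : ℂ) (p : E) : dLogC (fun _ => c) p = 0 := by
  ext v
  simp [dLogC]

end

theorem differentiableAt_zOf {E : Type*} [NormedAddCommGroup E] [NormedSpace ℝ E] {x y : E → ℂ}
    {p : E} (hx : DifferentiableAt ℝ x p) (hy : DifferentiableAt ℝ y p) (h : 1 - x p ≠ 0) :
    DifferentiableAt ℝ (fun q => zOf (x q) (y q)) p := by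
  unfold zOf
  have hn : DifferentiableAt ℝ (fun q => 1 + x q + 2 * x q * y q) p := by fun_prop
  have hd : DifferentiableAt ℝ (fun q => 1 - x q) p := by fun_prop
  simp only [div_eq_mul_inv]
  exact hn.fun_mul (hd.inv h)

theorem hasDerivAt_exp_ofReal_mul_I (s : ℝ) :
    HasDerivAt (fun r : ℝ => Complex.exp ((r : ℂ) * Complex.I))
      (Complex.exp ((s : ℂ) * Complex.I) * Complex.I) s := by
  have h := (((hasDerivAt_id s).ofReal_comp).mul_const Complex.I).cexp
  simpa using h

/-! ### The integral of `η(2, x, z)` over `B`. -/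

/-- The real part of `1 / (1 + c e^{-iψ})`. -/
noncomputable def poissonRe (c ψ : ℝ) : ℝ :=
  (1 + c * Real.cos ψ) / (1 + 2 * c * Real.cos ψ + c ^ 2)

/-- With `ψ = β + α/2`, `c = cos (α/2)` and `w = e^{iψ}`, the numerator of `z` is `2 e^{iα/2} (c +
w)`. Hence the `β`-derivative of `arg z` is `Re (w / (c + w))`. -/
theorem im_div_eq_poissonRe (α β : ℝ) :
    ((1 + Complex.exp ((α : ℂ) * Complex.I) + 2 * Complex.exp ((α : ℂ) * Complex.I) *
      Complex.exp ((β : ℂ) * Complex.I))⁻¹ * (2 * Complex.exp ((α : ℂ) * Complex.I) *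
      (Complex.exp ((β : ℂ) * Complex.I) * Complex.I))).im =
      poissonRe (Real.cos (α / 2)) (β + α / 2) := by
  set e := Complex.exp (((α / 2 : ℝ) : ℂ) * Complex.I) with he
  have he0 : e ≠ 0 := Complex.exp_ne_zero _
  have h1 : Complex.exp ((α : ℂ) * Complex.I) = e * e := by
    rw [he, ← Complex.exp_add]; congr 1; push_cast; ring
  have h2 : 1 + Complex.exp ((α : ℂ) * Complex.I) = 2 * (Real.cos (α / 2) : ℂ) * e := by
    rw [h1, Complex.ofReal_cos, Complex.two_cos, add_mul, ← he, neg_mul, Complex.exp_neg, ← he,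
      inv_mul_cancel₀ he0]
    ring
  have h3 : Complex.exp ((α : ℂ) * Complex.I) * Complex.exp ((β : ℂ) * Complex.I) =
      e * Complex.exp (((β + α / 2 : ℝ) : ℂ) * Complex.I) := by
    rw [he, ← Complex.exp_add, ← Complex.exp_add]; congr 1; push_cast; ring
  set w := Complex.exp (((β + α / 2 : ℝ) : ℂ) * Complex.I) with hw
  have h4 : (1 + Complex.exp ((α : ℂ) * Complex.I) + 2 * Complex.exp ((α : ℂ) * Complex.I) *
      Complex.exp ((β : ℂ) * Complex.I))⁻¹ * (2 * Complex.exp ((α : ℂ) * Complex.I) *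
      (Complex.exp ((β : ℂ) * Complex.I) * Complex.I)) =
      ((Real.cos (α / 2) : ℂ) + w)⁻¹ * (w * Complex.I) := by
    have e1 : 1 + Complex.exp ((α : ℂ) * Complex.I) + 2 * Complex.exp ((α : ℂ) * Complex.I) *
      Complex.exp ((β : ℂ) * Complex.I) = (2 * e) * ((Real.cos (α / 2) : ℂ) + w) := by
      rw [h2]; linear_combination 2 * h3
    have e2 : 2 * Complex.exp ((α : ℂ) * Complex.I) *
      (Complex.exp ((β : ℂ) * Complex.I) * Complex.I) = (2 * e) * (w * Complex.I) := by
      linear_combination 2 * Complex.I * h3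
    rw [e1, e2, mul_inv]
    field_simp
  rw [h4]
  have hwe : w = (Real.cos (β + α / 2) : ℂ) + (Real.sin (β + α / 2) : ℂ) * Complex.I := by
    rw [hw, Complex.exp_mul_I, Complex.ofReal_cos, Complex.ofReal_sin]
  have hsc := Real.sin_sq_add_cos_sq (β + α / 2)
  rw [poissonRe, hwe]
  set C := Real.cos (β + α / 2)
  set S := Real.sin (β + α / 2)
  set c := Real.cos (α / 2)
  simp only [Complex.mul_im, Complex.inv_re, Complex.inv_im, Complex.normSq_apply, Complex.add_re,
    Complex.add_im, Complex.mul_re, Complex.ofReal_re, Complex.ofReal_im, Complex.I_re,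
    Complex.I_im]
  have hd : 1 + 2 * c * C + c ^ 2 = (c + C) * (c + C) + S * S := by linear_combination -hsc
  have hn : 1 + c * C = (c + C) * C + S * S := by linear_combination -hsc
  rw [hd, hn]
  simp only [mul_zero, mul_one, sub_zero, zero_add, add_zero]
  ring

/-- Since `log |x|`, `d log |x|` and `d log 2` all vanish, only `-log 2 · d arg x ∧ d arg z`
survives. -/
theorem etaTwoCoeff_eq {t : ℝ × ℝ} (h : 1 - Complex.exp ((t.1 : ℂ) * Complex.I) ≠ 0) :
    etaTwoCoeff t = -Real.log 2 * poissonRe (Real.cos (t.1 / 2)) (t.2 + t.1 / 2) := by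
  have hx : DifferentiableAt ℝ (fun s : ℝ × ℝ => Complex.exp ((s.1 : ℂ) * Complex.I)) t := by
    have : DifferentiableAt ℝ (fun s : ℝ × ℝ => (s.1 : ℂ)) t :=
      Complex.ofRealCLM.differentiableAt.comp t differentiableAt_fst
    fun_prop
  have hy : DifferentiableAt ℝ (fun s : ℝ × ℝ => Complex.exp ((s.2 : ℂ) * Complex.I)) t := by
    have : DifferentiableAt ℝ (fun s : ℝ × ℝ => (s.2 : ℂ)) t :=
      Complex.ofRealCLM.differentiableAt.comp t differentiableAt_snd
    fun_prop
  have hz := differentiableAt_zOf hx hy h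
  have g1 : HasDerivAt (fun r : ℝ => (r, t.2)) (1, 0) t.1 :=
    (hasDerivAt_id t.1).prodMk (hasDerivAt_const _ _)
  have g2 : HasDerivAt (fun r : ℝ => (t.1, r)) (0, 1) t.2 :=
    (hasDerivAt_const _ _).prodMk (hasDerivAt_id t.2)
  have x1 := dLogC_apply_of_hasDerivAt hx g1 rfl (hasDerivAt_exp_ofReal_mul_I t.1)
  have x2 := dLogC_apply_of_hasDerivAt hx g2 rfl
    (hasDerivAt_const t.2 (Complex.exp ((t.1 : ℂ) * Complex.I)))
  have z2 := dLogC_apply_of_hasDerivAt hz g2 rfl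
    (((((hasDerivAt_exp_ofReal_mul_I t.2).const_mul
      (2 * Complex.exp ((t.1 : ℂ) * Complex.I))).const_add
      (1 + Complex.exp ((t.1 : ℂ) * Complex.I)))).div_const
      (1 - Complex.exp ((t.1 : ℂ) * Complex.I)))
  rw [inv_mul_cancel_left₀ (Complex.exp_ne_zero _)] at x1
  rw [mul_zero] at x2
  have z2' : (dLogC (fun s : ℝ × ℝ => zOf (Complex.exp ((s.1 : ℂ) * Complex.I))
      (Complex.exp ((s.2 : ℂ) * Complex.I))) t (0, 1)).im =
      poissonRe (Real.cos (t.1 / 2)) (t.2 + t.1 / 2) := by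
    rw [← im_div_eq_poissonRe, z2, zOf, inv_div]
    congr 1
    field_simp
  simp only [etaTwoCoeff, regulatorForm, etaSummand, ContinuousAlternatingMap.add_apply,
    ContinuousAlternatingMap.smul_apply, ContinuousAlternatingMap.sub_apply, wedge_apply, dLogAbs,
    dArg, ContinuousLinearMap.comp_apply, dLogC_const, Matrix.cons_val_zero, Matrix.cons_val_one,
    x1, x2, Complex.norm_exp_ofReal_mul_I, Complex.reCLM_apply, Complex.imCLM_apply, z2']
  simp

theorem poissonRe_den_pos {c : ℝ} (hc : c ^ 2 < 1) (ψ : ℝ) :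
    0 < 1 + 2 * c * Real.cos ψ + c ^ 2 := by
  have h := Real.sin_sq_add_cos_sq ψ
  nlinarith [sq_nonneg (Real.cos ψ + c), sq_nonneg (Real.cos ψ * c + 1),
    sq_nonneg (Real.cos ψ), sq_nonneg (Real.sin ψ), abs_le.mp (Real.abs_cos_le_one ψ)]

theorem one_add_mul_cos_pos {c : ℝ} (hc : c ^ 2 < 1) (ψ : ℝ) : 0 < 1 + c * Real.cos ψ := by
  have h2 : |c| < 1 := (sq_lt_one_iff_abs_lt_one c).mp hc
  have h3 : |c * Real.cos ψ| < 1 := by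
    rw [abs_mul]
    exact (mul_le_of_le_one_right (abs_nonneg _) (Real.abs_cos_le_one ψ)).trans_lt h2
  linarith [(abs_lt.mp h3).1]

/-- The integrand is the derivative of `arg (c + e^{iψ})`, `c = cos h`, written as `ψ` plus the
argument of `1 + c e^{-iψ}`. At `ψ = ±(π - h)` the number `c + e^{iψ}` is `±i sin h`, so the
argument runs from `-π/2` to `π/2`. -/
theorem integral_poissonRe {h : ℝ} (h0 : 0 < h) (h1 : h ≤ Real.pi / 2) :
    ∫ ψ in (-(Real.pi - h))..(Real.pi - h), poissonRe (Real.cos h) ψ = Real.pi := by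
  have hpi := Real.pi_pos
  have hs : 0 < Real.sin h := Real.sin_pos_of_pos_of_lt_pi h0 (by linarith)
  have hc : Real.cos h ^ 2 < 1 := by nlinarith [Real.sin_sq_add_cos_sq h, mul_pos hs hs]
  have hcont : Continuous fun ψ => poissonRe (Real.cos h) ψ := by
    unfold poissonRe
    exact Continuous.div (by fun_prop) (by fun_prop) fun ψ => (poissonRe_den_pos hc ψ).ne'
  rw [integral_eq_sub_of_hasDerivAt (f := fun ψ => ψ - Real.arctan
    (Real.cos h * Real.sin ψ / (1 + Real.cos h * Real.cos ψ))) _ (hcont.intervalIntegrable _ _)]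
  · have e : Real.arctan (Real.cos h * Real.sin h / (1 + Real.cos h * -Real.cos h)) =
        Real.pi / 2 - h := by
      have : Real.cos h * Real.sin h / (1 + Real.cos h * -Real.cos h) =
          Real.tan (Real.pi / 2 - h) := by
        rw [Real.tan_eq_sin_div_cos, Real.sin_pi_div_two_sub, Real.cos_pi_div_two_sub,
          div_eq_div_iff (by nlinarith) hs.ne']
        linear_combination Real.cos h * Real.sin_sq_add_cos_sq h
      rw [this, Real.arctan_tan (by linarith) (by linarith)]
    simp only [Real.sin_neg, Real.cos_neg, Real.sin_pi_sub, Real.cos_pi_sub, mul_neg, neg_div,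
      Real.arctan_neg]
    rw [mul_neg] at e
    rw [e]
    ring
  · intro ψ _
    have hp := (one_add_mul_cos_pos hc ψ).ne'
    have hd := poissonRe_den_pos hc ψ
    refine ((hasDerivAt_id ψ).sub ((((Real.hasDerivAt_sin ψ).const_mul (Real.cos h)).div
      (((Real.hasDerivAt_cos ψ).const_mul (Real.cos h)).const_add 1) hp).arctan)).congr_deriv ?_
    have hsc := Real.sin_sq_add_cos_sq ψ
    simp only [Pi.div_apply]
    have hden : 1 + (Real.cos h * Real.sin ψ / (1 + Real.cos h * Real.cos ψ)) ^ 2 =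
        (1 + 2 * Real.cos h * Real.cos ψ + Real.cos h ^ 2) /
          (1 + Real.cos h * Real.cos ψ) ^ 2 := by
      field_simp
      linear_combination Real.cos h ^ 2 * hsc
    have hnum : Real.cos h * Real.cos ψ * (1 + Real.cos h * Real.cos ψ) -
        Real.cos h * Real.sin ψ * (Real.cos h * -Real.sin ψ) =
        Real.cos h * Real.cos ψ + Real.cos h ^ 2 := by
      linear_combination Real.cos h ^ 2 * hsc
    rw [hden, hnum, poissonRe]
    field_simp
    ring

/-- In the variable `ψ = β + α/2` the section is the symmetric interval `|ψ| ≤ π - |α|/2`, as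
`integral_poissonRe` requires with `h = |α|/2`. -/
theorem regionB_section {α : ℝ} (h : α ∈ Set.Icc (-Real.pi) Real.pi) :
    {β | (α, β) ∈ regionB} =
      Set.Icc (-(Real.pi - |α| / 2) - α / 2) (Real.pi - |α| / 2 - α / 2) := by
  ext β
  simp only [regionB, Set.mem_ofPred_eq, Set.mem_Icc] at h ⊢
  rcases abs_cases α with ⟨h1, h2⟩ | ⟨h1, h2⟩ <;> rw [h1] <;> constructor
  · rintro ⟨_, ⟨a, b⟩, c, d⟩; constructor <;> linarith
  · rintro ⟨a, b⟩; exact ⟨h, ⟨by linarith, by linarith⟩, by linarith, by linarith⟩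
  · rintro ⟨_, ⟨a, b⟩, c, d⟩; constructor <;> linarith
  · rintro ⟨a, b⟩; exact ⟨h, ⟨by linarith, by linarith⟩, by linarith, by linarith⟩

theorem measurableSet_regionB : MeasurableSet regionB := by
  have h1 : MeasurableSet {t : ℝ × ℝ | t.1 ∈ Set.Icc (-Real.pi) Real.pi} :=
    measurable_fst measurableSet_Icc
  have h2 : MeasurableSet {t : ℝ × ℝ | t.2 ∈ Set.Icc (-Real.pi) Real.pi} :=
    measurable_snd measurableSet_Icc
  have h3 : MeasurableSet {t : ℝ × ℝ | t.1 + t.2 ∈ Set.Icc (-Real.pi) Real.pi} :=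
    (measurable_fst.add measurable_snd) measurableSet_Icc
  exact h1.inter (h2.inter h3)

theorem integral_regionB_section {α : ℝ} (h : α ∈ Set.Icc (-Real.pi) Real.pi) (h0 : α ≠ 0) :
    IntegrableOn (fun β => poissonRe (Real.cos (α / 2)) (β + α / 2)) {β | (α, β) ∈ regionB} ∧
    (∀ β, 0 ≤ poissonRe (Real.cos (α / 2)) (β + α / 2)) ∧
    ∫ β in {β | (α, β) ∈ regionB}, poissonRe (Real.cos (α / 2)) (β + α / 2) = Real.pi := by
  have hpi := Real.pi_pos
  have ha : 0 < |α| := abs_pos.mpr h0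
  have ha' : |α| ≤ Real.pi := abs_le.mpr h
  have hcos : Real.cos (α / 2) = Real.cos (|α| / 2) := by
    rw [← Real.cos_abs, abs_div, abs_two]
  have hs : 0 < Real.sin (|α| / 2) := Real.sin_pos_of_pos_of_lt_pi (by linarith) (by linarith)
  have hc : Real.cos (|α| / 2) ^ 2 < 1 := by
    nlinarith [Real.sin_sq_add_cos_sq (|α| / 2), mul_pos hs hs]
  have hcont : Continuous fun β => poissonRe (Real.cos (α / 2)) (β + α / 2) := by
    unfold poissonRe
    rw [hcos]
    exact Continuous.div (by fun_prop) (by fun_prop) fun ψ => (poissonRe_den_pos hc _).ne'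
  rw [regionB_section h]
  refine ⟨hcont.continuousOn.integrableOn_compact isCompact_Icc, fun β => ?_, ?_⟩
  · rw [hcos]
    exact div_nonneg (one_add_mul_cos_pos hc _).le (poissonRe_den_pos hc _).le
  · rw [integral_Icc_eq_integral_Ioc, ← intervalIntegral.integral_of_le (by linarith),
      intervalIntegral.integral_comp_add_right (fun ψ => poissonRe (Real.cos (α / 2)) ψ), hcos,
      sub_add_cancel, sub_add_cancel, integral_poissonRe (by linarith) (by linarith)]

theorem ae_fst_ne_zero : ∀ᵐ t : ℝ × ℝ, t.1 ≠ 0 :=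
  Measure.quasiMeasurePreserving_fst.ae (Measure.ae_ne volume (0 : ℝ))

/-- Positivity makes the `L¹` norm of almost every section equal to its integral `π`, so the same
computation yields integrability and the value `2π · π`. The null line `α = 0` is discarded, as the
denominator can vanish there. -/
theorem integral_regionB_poissonRe :
    IntegrableOn (fun t : ℝ × ℝ => poissonRe (Real.cos (t.1 / 2)) (t.2 + t.1 / 2)) regionB ∧
    ∫ t in regionB, poissonRe (Real.cos (t.1 / 2)) (t.2 + t.1 / 2) = 2 * Real.pi ^ 2 := by
  have hpi := Real.pi_pos
  set g : ℝ × ℝ → ℝ := fun t => poissonRe (Real.cos (t.1 / 2)) (t.2 + t.1 / 2) with hg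
  have hgm : Measurable g := by
    unfold g poissonRe
    fun_prop
  have hsec : ∀ α : ℝ, (fun β => regionB.indicator g (α, β)) =
      {β | (α, β) ∈ regionB}.indicator fun β => poissonRe (Real.cos (α / 2)) (β + α / 2) := by
    intro α
    ext β
    rfl
  have hsm : ∀ α : ℝ, MeasurableSet {β | (α, β) ∈ regionB} := fun α =>
    measurable_prodMk_left measurableSet_regionB
  have hout : ∀ α ∉ Set.Icc (-Real.pi) Real.pi, {β | (α, β) ∈ regionB} = ∅ := by
    intro α hα
    ext β
    simp only [regionB, Set.mem_ofPred_eq, Set.mem_empty_iff_false, iff_false]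
    exact fun h => hα h.1
  have hae : ∀ᵐ α : ℝ, α ≠ 0 := Measure.ae_ne volume 0
  have hI1 : ∀ᵐ α : ℝ, ∫ β, regionB.indicator g (α, β) =
      (Set.Icc (-Real.pi) Real.pi).indicator (fun _ => Real.pi) α := by
    filter_upwards [hae] with α hα
    rw [hsec, MeasureTheory.integral_indicator (hsm α)]
    by_cases h : α ∈ Set.Icc (-Real.pi) Real.pi
    · rw [Set.indicator_of_mem h, (integral_regionB_section h hα).2.2]
    · rw [Set.indicator_of_notMem h, hout α h]
      simp
  have hI2 : ∀ᵐ α : ℝ, ∫ β, ‖regionB.indicator g (α, β)‖ =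
      (Set.Icc (-Real.pi) Real.pi).indicator (fun _ => Real.pi) α := by
    filter_upwards [hae, hI1] with α hα h1
    rw [← h1]
    congr 1
    ext β
    refine Real.norm_of_nonneg ?_
    by_cases h : (α, β) ∈ regionB
    · rw [Set.indicator_of_mem h]
      exact (integral_regionB_section h.1 hα).2.1 β
    · rw [Set.indicator_of_notMem h]
  have hconst : Integrable ((Set.Icc (-Real.pi) Real.pi).indicator (fun _ => Real.pi)) := by
    rw [integrable_indicator_iff measurableSet_Icc]
    exact integrableOn_const isCompact_Icc.measure_lt_top.ne
  have hint : Integrable (regionB.indicator g) (volume.prod volume) := by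
    rw [integrable_prod_iff (hgm.indicator measurableSet_regionB).aestronglyMeasurable]
    constructor
    · filter_upwards [hae] with α hα
      rw [hsec, integrable_indicator_iff (hsm α)]
      by_cases h : α ∈ Set.Icc (-Real.pi) Real.pi
      · exact (integral_regionB_section h hα).1
      · rw [hout α h]
        exact integrableOn_empty
    · exact hconst.congr (hI2.mono fun _ h => h.symm)
  constructor
  · rw [← integrable_indicator_iff measurableSet_regionB]
    exact hint
  · rw [← MeasureTheory.integral_indicator measurableSet_regionB, Measure.volume_eq_prod, integral_prod _ hint,
      integral_congr_ae hI1, MeasureTheory.integral_indicator measurableSet_Icc]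
    simp [hpi.le]
    ring

theorem etaTwoCoeff_ae_eq : ∀ᵐ t ∂volume.restrict regionB,
    -Real.log 2 * poissonRe (Real.cos (t.1 / 2)) (t.2 + t.1 / 2) = etaTwoCoeff t := by
  filter_upwards [ae_restrict_mem measurableSet_regionB,
    ae_restrict_of_ae ae_fst_ne_zero] with t ht h0
  refine (etaTwoCoeff_eq fun h => h0 ?_).symm
  have hs := congrArg Complex.re h
  rw [Complex.sub_re, Complex.exp_ofReal_mul_I_re, Complex.one_re, Complex.zero_re] at hs
  exact (Real.cos_eq_one_iff_of_lt_of_lt (by linarith [ht.1.1, Real.pi_pos])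
    (by linarith [ht.1.2, Real.pi_pos])).mp (by linarith)

theorem integral_etaTwoCoeff : IntegrableOn etaTwoCoeff regionB ∧
    ∫ t in regionB, etaTwoCoeff t = -(2 * Real.pi ^ 2 * Real.log 2) := by
  obtain ⟨h1, h2⟩ := integral_regionB_poissonRe
  constructor
  · exact (h1.const_mul (-Real.log 2)).congr etaTwoCoeff_ae_eq
  · rw [← integral_congr_ae etaTwoCoeff_ae_eq, MeasureTheory.integral_const_mul, h2]
    ring

/-! ### Stokes' theorem for doubly periodic surfaces. -/

/-- Stokes' theorem on a torus: the integral of an exact 2-form over a doubly periodic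
parametrized surface vanishes. -/
theorem integral_extDeriv_periodic_eq_zero {F : Type*} [NormedAddCommGroup F] [NormedSpace ℝ F]
    {φ : F → F [⋀^Fin 1]→L[ℝ] ℝ} {Φ : ℝ × ℝ → F} {T : ℝ} (hΦ : ContDiff ℝ 2 Φ)
    (h1 : ∀ t, Φ (t + (T, 0)) = Φ t) (h2 : ∀ t, Φ (t + (0, T)) = Φ t)
    (hφ : ∀ t, DifferentiableAt ℝ φ (Φ t)) {h : ℝ × ℝ → ℝ} (hh : Continuous h)
    (hval : ∀ t, extDeriv φ (Φ t) ![fderiv ℝ Φ t (1, 0), fderiv ℝ Φ t (0, 1)] = h t) :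
    ∫ x in (0 : ℝ)..T, ∫ y in (0 : ℝ)..T, h (x, y) = 0 := by
  set θ : ℝ × ℝ → (ℝ × ℝ) [⋀^Fin 1]→L[ℝ] ℝ := fun t =>
    (φ (Φ t)).compContinuousLinearMap (fderiv ℝ Φ t) with hθ
  have hθd : Differentiable ℝ θ := by
    intro t
    have hd : DifferentiableAt ℝ (fderiv ℝ Φ) t :=
      (hΦ.fderiv_right (m := 1) (by norm_num)).differentiable one_ne_zero t
    exact ((hφ t).comp t (hΦ.differentiable two_ne_zero t)
      ).continuousAlternatingMapCompContinuousLinearMap hd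
  have hper : ∀ a : ℝ × ℝ, (∀ t, Φ (t + a) = Φ t) → ∀ t, θ (t + a) = θ t := by
    intro a ha t
    have : fderiv ℝ Φ (t + a) = fderiv ℝ Φ t := by
      rw [← fderiv_comp_add_right]
      simp only [ha]
    simp only [hθ, this, ha]
  have hfd : ∀ v : Fin 1 → ℝ × ℝ, Differentiable ℝ fun t => θ t v := fun v t =>
    (hθd t).continuousAlternatingMap_apply_const v
  have hext : ∀ t, fderiv ℝ (fun t => θ t ![(0, 1)]) t (1, 0) +
      fderiv ℝ (fun t => -θ t ![(1, 0)]) t (0, 1) = h t := by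
    intro t
    rw [← hval t]
    have hp := extDeriv_pullback (x := t) (r := 2) (hφ t) hΦ.contDiffAt (by simp)
    have hp' := congrArg (fun η : (ℝ × ℝ) [⋀^Fin 2]→L[ℝ] ℝ => η ![(1, 0), (0, 1)]) hp
    rw [extDeriv_apply (hθd t), ContinuousAlternatingMap.compContinuousLinearMap_apply,
      Fin.sum_univ_two] at hp'
    have e0 : (0 : Fin 2).removeNth ![((1 : ℝ), (0 : ℝ)), (0, 1)] = ![(0, 1)] := by
      ext i <;> fin_cases i <;> rfl
    have e1 : (1 : Fin 2).removeNth ![((1 : ℝ), (0 : ℝ)), (0, 1)] = ![(1, 0)] := by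
      ext i <;> fin_cases i <;> rfl
    have e2 : (⇑(fderiv ℝ Φ t) ∘ ![((1 : ℝ), (0 : ℝ)), (0, 1)]) =
        ![fderiv ℝ Φ t (1, 0), fderiv ℝ Φ t (0, 1)] := by
      ext i
      fin_cases i <;> rfl
    rw [e0, e1, e2] at hp'
    rw [← hp']
    simp [fderiv_fun_neg]
  -- The coefficient of the derivative of the pulled-back form `θ` is the divergence of `(θ(0,1),
  -- -θ(1,0))`; by periodicity opposite edges of the square cancel.
  have hdiv := integral2_divergence_prod_of_hasFDerivAt (fun t => θ t ![(0, 1)])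
    (fun t => -θ t ![(1, 0)]) (fderiv ℝ (fun t => θ t ![(0, 1)]))
    (fderiv ℝ (fun t => -θ t ![(1, 0)])) 0 0 T T (hfd _).continuous.continuousOn
    (hfd _).neg.continuous.continuousOn (fun t _ => (hfd _ t).hasFDerivAt)
    (fun t _ => ((hfd _).neg t).hasFDerivAt)
    (by
      simp only [hext]
      exact hh.continuousOn.integrableOn_compact (isCompact_uIcc.prod isCompact_uIcc))
  simp only [hext] at hdiv
  rw [hdiv]
  have p1 : ∀ y, θ (T, y) = θ (0, y) := fun y => by
    simpa using hper (T, 0) h1 (0, y)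
  have p2 : ∀ x, θ (x, T) = θ (x, 0) := fun x => by
    simpa using hper (0, T) h2 (x, 0)
  simp only [p1, p2]
  ring

/-! ### Non-exactness of `η(x, y, z)`: a torus with nonzero period. -/

/-- The function `y` on the surface, in terms of `x` and `z`. -/
noncomputable def yOf (x z : ℂ) : ℂ := ((1 - x) * z - 1 - x) / (2 * x)

theorem one_add_add_two_mul_yOf {x : ℂ} (hx : x ≠ 0) (z : ℂ) :
    1 + x + 2 * x * yOf x z = (1 - x) * z := by
  rw [yOf]
  field_simp
  ring

theorem zOf_yOf {x : ℂ} (hx : x ≠ 0) (hx1 : 1 - x ≠ 0) (z : ℂ) : zOf x (yOf x z) = z := by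
  rw [zOf, one_add_add_two_mul_yOf hx, mul_div_cancel_left₀ _ hx1]

/-- This expression is `-2xy`. Radii below `1/3` confine it to the right half-plane, where the
principal logarithm is holomorphic and the denominators are nonzero. -/
theorem re_one_add_sub_pos {x z : ℂ} (hx : ‖x‖ < 1 / 3) (hz : ‖z‖ < 1 / 3) :
    0 < (1 + x - (1 - x) * z).re := by
  have h1 : ‖x - (1 - x) * z‖ < 1 := by
    have h2 : ‖1 - x‖ ≤ 4 / 3 := by
      refine (norm_sub_le _ _).trans ?_
      rw [norm_one]; linarith
    calc ‖x - (1 - x) * z‖ ≤ ‖x‖ + ‖1 - x‖ * ‖z‖ := by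
          rw [← norm_mul]; exact norm_sub_le _ _
      _ ≤ ‖x‖ + 4 / 3 * ‖z‖ := by gcongr
      _ < 1 := by linarith
  have h3 := (abs_lt.mp ((Complex.abs_re_le_norm _).trans_lt h1)).1
  have h4 : 1 + x - (1 - x) * z = 1 + (x - (1 - x) * z) := by ring
  rw [h4, Complex.add_re, Complex.one_re]
  linarith

/-- A function, holomorphic in `x` and in `z`, whose real part is the coefficient of
`η(x, y, z)` on the torus `|x| = r`, `|z| = s`. -/
noncomputable def torusFun (r s : ℝ) (x z : ℂ) : ℂ :=
  -(Real.log 2 : ℂ) + Complex.log (1 + x - (1 - x) * z)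
    - (Real.log r : ℂ) * (x * (1 + z) / (1 + x - (1 - x) * z))
    + (Real.log s : ℂ) * ((1 - x) * z / (1 + x - (1 - x) * z))

theorem integral_circleMap_eq {f : ℂ → ℂ} {r : ℝ} (hr : 0 < r)
    (hf : ∀ x : ℂ, ‖x‖ ≤ r → DifferentiableAt ℂ f x) :
    ∫ α in (0 : ℝ)..(2 * Real.pi), f (circleMap 0 r α) = 2 * Real.pi * f 0 := by
  have h := DiffContOnCl.circleAverage (f := f) (c := 0) (R := r) ?_
  · rw [Real.circleAverage_def] at h
    rw [← h, Complex.real_smul]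
    push_cast
    rw [mul_inv_cancel_left₀]
    exact mul_ne_zero two_ne_zero (Complex.ofReal_ne_zero.mpr Real.pi_ne_zero)
  · refine DifferentiableOn.diffContOnCl fun x hx => (hf x ?_).differentiableWithinAt
    rw [abs_of_pos hr] at hx
    simpa using Metric.closure_ball_subset_closedBall hx

theorem differentiableAt_torusFun_left (r s : ℝ) {x z : ℂ} (hx : ‖x‖ < 1 / 3)
    (hz : ‖z‖ < 1 / 3) : DifferentiableAt ℂ (fun x => torusFun r s x z) x := by
  have h := re_one_add_sub_pos hx hz
  have h0 : 1 + x - (1 - x) * z ≠ 0 := fun h' => by simp [h'] at h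
  have hd : DifferentiableAt ℂ (fun x => 1 + x - (1 - x) * z) x := by fun_prop
  unfold torusFun
  exact (((hd.clog (Or.inl h)).const_add _).fun_sub
    (((by fun_prop : DifferentiableAt ℂ (fun x => x * (1 + z)) x).fun_div hd h0).const_mul _)).fun_add
    (((by fun_prop : DifferentiableAt ℂ (fun x => (1 - x) * z) x).fun_div hd h0).const_mul _)

theorem differentiableAt_torusFun_right (r s : ℝ) {x z : ℂ} (hx : ‖x‖ < 1 / 3)
    (hz : ‖z‖ < 1 / 3) : DifferentiableAt ℂ (fun z => torusFun r s x z) z := by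
  have h := re_one_add_sub_pos hx hz
  have h0 : 1 + x - (1 - x) * z ≠ 0 := fun h' => by simp [h'] at h
  have hd : DifferentiableAt ℂ (fun z => 1 + x - (1 - x) * z) z := by fun_prop
  unfold torusFun
  exact (((hd.clog (Or.inl h)).const_add _).fun_sub
    (((by fun_prop : DifferentiableAt ℂ (fun z => x * (1 + z)) z).fun_div hd h0).const_mul _)).fun_add
    (((by fun_prop : DifferentiableAt ℂ (fun z => (1 - x) * z) z).fun_div hd h0).const_mul _)

theorem norm_circleMap_lt {r : ℝ} (hr : 0 < r) (hr3 : r < 1 / 3) (α : ℝ) :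
    ‖circleMap 0 r α‖ < 1 / 3 := by
  rwa [norm_circleMap_zero, abs_of_pos hr]

theorem continuous_torusFun {r s : ℝ} (hr : 0 < r) (hr3 : r < 1 / 3) (hs : 0 < s)
    (hs3 : s < 1 / 3) :
    Continuous fun t : ℝ × ℝ => torusFun r s (circleMap 0 r t.1) (circleMap 0 s t.2) := by
  have hx : Continuous fun t : ℝ × ℝ => circleMap 0 r t.1 :=
    (continuous_circleMap 0 r).comp continuous_fst
  have hz : Continuous fun t : ℝ × ℝ => circleMap 0 s t.2 :=
    (continuous_circleMap 0 s).comp continuous_snd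
  have hp := fun t : ℝ × ℝ => re_one_add_sub_pos (norm_circleMap_lt hr hr3 t.1)
    (norm_circleMap_lt hs hs3 t.2)
  have h0 : ∀ t : ℝ × ℝ, 1 + circleMap 0 r t.1 - (1 - circleMap 0 r t.1) * circleMap 0 s t.2 ≠ 0 :=
    fun t h' => by simpa [h'] using hp t
  have hd : Continuous fun t : ℝ × ℝ => 1 + circleMap 0 r t.1 -
    (1 - circleMap 0 r t.1) * circleMap 0 s t.2 := by fun_prop
  unfold torusFun
  exact ((continuous_const.add (hd.clog fun t => Or.inl (hp t))).sub
    (continuous_const.mul (Continuous.div (by fun_prop) hd h0))).add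
    (continuous_const.mul (Continuous.div (by fun_prop) hd h0))

/-- The mean value property in `z`, then in `x`, leaves `(2π)²` times the value at the origin, `-log
2`. -/
theorem integral_re_torusFun {r s : ℝ} (hr : 0 < r) (hr3 : r < 1 / 3) (hs : 0 < s)
    (hs3 : s < 1 / 3) :
    ∫ α in (0 : ℝ)..(2 * Real.pi), ∫ β in (0 : ℝ)..(2 * Real.pi),
      (torusFun r s (circleMap 0 r α) (circleMap 0 s β)).re =
      -(4 * Real.pi ^ 2 * Real.log 2) := by
  have hc := continuous_torusFun hr hr3 hs hs3
  have h1 : ∀ α : ℝ, ∫ β in (0 : ℝ)..(2 * Real.pi),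
      (torusFun r s (circleMap 0 r α) (circleMap 0 s β)).re =
      (2 * Real.pi * torusFun r s (circleMap 0 r α) 0).re := by
    intro α
    have hi : IntervalIntegrable (fun β => torusFun r s (circleMap 0 r α) (circleMap 0 s β))
        volume 0 (2 * Real.pi) :=
      (hc.comp (Continuous.prodMk_right α)).intervalIntegrable _ _
    rw [← integral_circleMap_eq hs fun z hz => differentiableAt_torusFun_right r s
      (norm_circleMap_lt hr hr3 α) (hz.trans_lt hs3)]
    exact Complex.reCLM.intervalIntegral_comp_comm hi
  have h0 : ‖(0 : ℂ)‖ < 1 / 3 := by simp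
  have hi : IntervalIntegrable (fun α => 2 * Real.pi * torusFun r s (circleMap 0 r α) 0)
      volume 0 (2 * Real.pi) := by
    refine Continuous.intervalIntegrable (continuous_const.mul ?_) _ _
    refine continuous_iff_continuousAt.mpr fun α => ?_
    exact ContinuousAt.comp (g := fun x => torusFun r s x 0)
      (differentiableAt_torusFun_left r s (norm_circleMap_lt hr hr3 α) h0).continuousAt
      (continuous_circleMap 0 r).continuousAt
  simp only [h1]
  have h2 := Complex.reCLM.intervalIntegral_comp_comm hi
  simp only [Complex.reCLM_apply] at h2
  rw [h2, intervalIntegral.integral_const_mul, integral_circleMap_eq hr fun x hx =>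
    differentiableAt_torusFun_left r s (hx.trans_lt hr3) h0]
  have h3 : torusFun r s 0 0 = -(Real.log 2 : ℂ) := by simp [torusFun]
  rw [h3]
  have h4 : (2 * Real.pi * (2 * Real.pi * -(Real.log 2 : ℂ)) : ℂ) =
      ((-(4 * Real.pi ^ 2 * Real.log 2) : ℝ) : ℂ) := by push_cast; ring
  rw [h4, Complex.ofReal_re]

/-- The torus `|x| = r`, `|z| = s` on the surface, in the coordinates `(x, y)`. -/
noncomputable def surfaceTorus (r s : ℝ) (t : ℝ × ℝ) : ℂ × ℂ :=
  (circleMap 0 r t.1, yOf (circleMap 0 r t.1) (circleMap 0 s t.2))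

theorem circleMap_zero_ne_zero {r : ℝ} (hr : 0 < r) (α : ℝ) : circleMap 0 r α ≠ 0 :=
  circleMap_ne_center hr.ne'

theorem one_sub_circleMap_ne_zero {r : ℝ} (hr : 0 < r) (hr3 : r < 1 / 3) (α : ℝ) :
    1 - circleMap 0 r α ≠ 0 := by
  intro h
  have h1 := norm_circleMap_lt hr hr3 α
  rw [← sub_eq_zero.mp h, norm_one] at h1
  linarith

theorem contDiff_circleMap_zero (r : ℝ) : ContDiff ℝ 2 (circleMap 0 r) := by
  unfold circleMap
  have : ContDiff ℝ 2 (fun θ : ℝ => (θ : ℂ)) := Complex.ofRealCLM.contDiff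
  fun_prop

theorem contDiff_surfaceTorus {r : ℝ} (hr : 0 < r) (s : ℝ) : ContDiff ℝ 2 (surfaceTorus r s) := by
  have hx : ContDiff ℝ 2 fun t : ℝ × ℝ => circleMap 0 r t.1 :=
    (contDiff_circleMap_zero r).comp contDiff_fst
  have hz : ContDiff ℝ 2 fun t : ℝ × ℝ => circleMap 0 s t.2 :=
    (contDiff_circleMap_zero s).comp contDiff_snd
  unfold surfaceTorus yOf
  simp only [div_eq_mul_inv]
  refine hx.prodMk ((by fun_prop : ContDiff ℝ 2 fun t : ℝ × ℝ =>
    (1 - circleMap 0 r t.1) * circleMap 0 s t.2 - 1 - circleMap 0 r t.1).mul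
    ((contDiff_const.mul hx).inv fun t => ?_))
  exact mul_ne_zero two_ne_zero (circleMap_zero_ne_zero hr t.1)

theorem yOf_eq_neg_div (x z : ℂ) : yOf x z = -(1 + x - (1 - x) * z) / (2 * x) := by
  rw [yOf]
  ring

/-- On the torus `log |x|` and `log |z|` are constant, `d arg x = dα`, `d arg z = dβ`. What remains
is `log |y| - log r · ∂_α arg y - log s · ∂_β arg y`; the `-log r` in `log |y|` cancels against the
`-1` in `∂_α arg y`. -/
theorem etaSurface_surfaceTorus {r s : ℝ} (hr : 0 < r) (hr3 : r < 1 / 3) (hs : 0 < s)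
    (hs3 : s < 1 / 3) (t : ℝ × ℝ) :
    etaSurface (surfaceTorus r s t)
      ![fderiv ℝ (surfaceTorus r s) t (1, 0), fderiv ℝ (surfaceTorus r s) t (0, 1)] =
    (torusFun r s (circleMap 0 r t.1) (circleMap 0 s t.2)).re := by
  have hx0 := circleMap_zero_ne_zero hr
  have hx1 := one_sub_circleMap_ne_zero hr hr3
  have hz0 := circleMap_zero_ne_zero hs t.2
  have hWp := re_one_add_sub_pos (norm_circleMap_lt hr hr3 t.1) (norm_circleMap_lt hs hs3 t.2)
  have hW : 1 + circleMap 0 r t.1 - (1 - circleMap 0 r t.1) * circleMap 0 s t.2 ≠ 0 :=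
    fun h' => by simp [h'] at hWp
  have hΦ := ((contDiff_surfaceTorus hr s).differentiable two_ne_zero t).hasFDerivAt
  have g1 : HasDerivAt (fun ρ : ℝ => surfaceTorus r s (ρ, t.2)) (fderiv ℝ (surfaceTorus r s) t (1, 0))
      t.1 :=
    HasFDerivAt.comp_hasDerivAt t.1 (f := fun ρ : ℝ => (ρ, t.2)) hΦ
      ((hasDerivAt_id t.1).prodMk (hasDerivAt_const _ _))
  have g2 : HasDerivAt (fun ρ : ℝ => surfaceTorus r s (t.1, ρ)) (fderiv ℝ (surfaceTorus r s) t (0, 1))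
      t.2 :=
    HasFDerivAt.comp_hasDerivAt t.2 (f := fun ρ : ℝ => (t.1, ρ)) hΦ
      ((hasDerivAt_const _ _).prodMk (hasDerivAt_id t.2))
  have hzd : DifferentiableAt ℝ (fun p : ℂ × ℂ => zOf p.1 p.2) (surfaceTorus r s t) :=
    differentiableAt_zOf differentiableAt_fst differentiableAt_snd (hx1 t.1)
  have hzv : ∀ t : ℝ × ℝ, zOf (surfaceTorus r s t).1 (surfaceTorus r s t).2 = circleMap 0 s t.2 :=
    fun t => zOf_yOf (hx0 t.1) (hx1 t.1) _
  have hcx := hasDerivAt_circleMap 0 r t.1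
  have hcz := hasDerivAt_circleMap 0 s t.2
  have x1 := dLogC_apply_of_hasDerivAt (f := fun p : ℂ × ℂ => p.1) differentiableAt_fst g1 rfl hcx
  have x2 := dLogC_apply_of_hasDerivAt (f := fun p : ℂ × ℂ => p.1) differentiableAt_fst g2 rfl
    (hasDerivAt_const t.2 (circleMap 0 r t.1))
  have z1 := dLogC_apply_of_hasDerivAt hzd g1 rfl (d := 0)
    (by simp only [hzv]; exact hasDerivAt_const _ _)
  have z2 := dLogC_apply_of_hasDerivAt hzd g2 rfl (d := circleMap 0 s t.2 * Complex.I)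
    (by simp only [hzv]; exact hcz)
  have y1 := dLogC_apply_of_hasDerivAt (f := fun p : ℂ × ℂ => p.2) differentiableAt_snd g1 rfl
    (((((hcx.const_sub 1).mul_const (circleMap 0 s t.2)).sub_const 1).sub hcx).div
      (hcx.const_mul 2) (mul_ne_zero two_ne_zero (hx0 t.1)))
  have y2 := dLogC_apply_of_hasDerivAt (f := fun p : ℂ × ℂ => p.2) differentiableAt_snd g2 rfl
    ((((hcz.const_mul (1 - circleMap 0 r t.1)).sub_const 1).sub_const
      (circleMap 0 r t.1)).div_const (2 * circleMap 0 r t.1))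
  have nx : ‖(surfaceTorus r s t).1‖ = r := by
    simp [surfaceTorus, abs_of_pos hr]
  have nz : ‖zOf (surfaceTorus r s t).1 (surfaceTorus r s t).2‖ = s := by
    rw [hzv, norm_circleMap_zero, abs_of_pos hs]
  have ny : Real.log ‖(surfaceTorus r s t).2‖ = Real.log ‖1 + circleMap 0 r t.1 -
      (1 - circleMap 0 r t.1) * circleMap 0 s t.2‖ - (Real.log 2 + Real.log r) := by
    have : (surfaceTorus r s t).2 = _ := yOf_eq_neg_div _ _
    rw [this, norm_div, norm_neg, norm_mul, norm_circleMap_zero, abs_of_pos hr,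
      Real.log_div (norm_ne_zero_iff.mpr hW) (by simpa using hr.ne'), Complex.norm_two,
      Real.log_mul two_ne_zero hr.ne']
  have hxe : (surfaceTorus r s t).1 = circleMap 0 r t.1 := rfl
  simp only [Prod.mk.eta, Pi.sub_apply, hxe] at x1 x2 y1 y2
  rw [inv_mul_cancel_left₀ (hx0 t.1)] at x1
  rw [hzv, inv_mul_cancel_left₀ hz0] at z2
  rw [mul_zero] at x2 z1
  set x := circleMap 0 r t.1 with hx
  set z := circleMap 0 s t.2 with hz
  have hxt : x ≠ 0 := hx0 t.1
  have hy : (surfaceTorus r s t).2 = -(1 + x - (1 - x) * z) / (2 * x) := yOf_eq_neg_div _ _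
  have y1' : dLogC (fun p : ℂ × ℂ => p.2) (surfaceTorus r s t) (fderiv ℝ (surfaceTorus r s) t (1, 0)) =
      Complex.I * (x * (1 + z) / (1 + x - (1 - x) * z) - 1) := by
    rw [y1, hy]
    field_simp
    ring
  have y2' : dLogC (fun p : ℂ × ℂ => p.2) (surfaceTorus r s t) (fderiv ℝ (surfaceTorus r s) t (0, 1)) =
      -(Complex.I * ((1 - x) * z / (1 + x - (1 - x) * z))) := by
    rw [y2, hy]
    field_simp
  simp only [etaSurface, regulatorForm, etaSummand, ContinuousAlternatingMap.add_apply,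
    ContinuousAlternatingMap.smul_apply, ContinuousAlternatingMap.sub_apply, wedge_apply, dLogAbs,
    dArg, ContinuousLinearMap.comp_apply, Matrix.cons_val_zero, Matrix.cons_val_one,
    x1, x2, z1, z2, y1', y2', nx, nz, ny, Complex.reCLM_apply, Complex.imCLM_apply, torusFun,
    Complex.add_re, Complex.sub_re, Complex.neg_re, Complex.neg_im, Complex.re_ofReal_mul,
    Complex.log_re, Complex.ofReal_re, Complex.I_mul_re, Complex.I_mul_im, Complex.I_re,
    Complex.I_im, Complex.zero_re, Complex.zero_im, Complex.sub_im, Complex.one_re, Complex.one_im,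
    smul_eq_mul]
  ring

/-- Clears the powers of `2x` in the denominator of `f(x, y)`; in `g` the outer variable is `z`. -/
theorem exists_evalEval_eq (f : MvPolynomial (Fin 2) ℂ) :
    ∃ (N : ℕ) (g : Polynomial (Polynomial ℂ)), ∀ x z : ℂ, x ≠ 0 →
      (2 * x) ^ N * MvPolynomial.eval ![x, yOf x z] f = g.evalEval x z := by
  induction f using MvPolynomial.induction_on with
  | C a => exact ⟨0, Polynomial.C (Polynomial.C a), fun x z _ => by simp⟩
  | add p q hp hq =>
    obtain ⟨N, g, hg⟩ := hp
    obtain ⟨M, h, hh⟩ := hq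
    refine ⟨N + M, Polynomial.C ((2 * Polynomial.X) ^ M) * g +
      Polynomial.C ((2 * Polynomial.X) ^ N) * h, fun x z hx => ?_⟩
    simp only [Polynomial.evalEval_add, Polynomial.evalEval_mul, ← hg x z hx, ← hh x z hx,
      Polynomial.evalEval_C, Polynomial.eval_pow, Polynomial.eval_mul, Polynomial.eval_X,
      Polynomial.eval_ofNat, map_add]
    ring
  | mul_X p i hp =>
    obtain ⟨N, g, hg⟩ := hp
    fin_cases i
    · refine ⟨N, g * Polynomial.C Polynomial.X, fun x z hx => ?_⟩
      simp only [Polynomial.evalEval_mul, ← hg x z hx, Polynomial.evalEval_C, Polynomial.eval_X,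
        map_mul, MvPolynomial.eval_X]
      simp
      ring
    · refine ⟨N + 1, g * (Polynomial.C (1 - Polynomial.X) * Polynomial.X -
        Polynomial.C (1 + Polynomial.X)), fun x z hx => ?_⟩
      simp only [Polynomial.evalEval_mul, Polynomial.evalEval_sub, ← hg x z hx,
        Polynomial.evalEval_C, Polynomial.eval_X, map_mul, MvPolynomial.eval_X,
        Polynomial.eval_sub, Polynomial.eval_add, Polynomial.eval_one, Polynomial.evalEval_X]
      have h := one_add_add_two_mul_yOf hx z
      have h' : (1 - x) * z - (1 + x) = 2 * x * yOf x z := by linear_combination -h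
      rw [h']
      simp
      ring

theorem continuous_evalEval (g : Polynomial (Polynomial ℂ)) :
    Continuous fun p : ℂ × ℂ => g.evalEval p.2 p.1 := by
  induction g using Polynomial.induction_on' with
  | add p q hp hq =>
    simp only [Polynomial.evalEval_add]
    exact hp.add hq
  | monomial n a =>
    simp only [Polynomial.evalEval, Polynomial.eval_monomial, Polynomial.eval_mul,
      Polynomial.eval_pow, Polynomial.eval_C]
    have := a.continuous.comp (continuous_snd (X := ℂ) (Y := ℂ))
    fun_prop

/-- Removing the largest power of `z` from `g` leaves `q` with `q(x, 0)` a nonzero polynomial.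
Choose `r` off the moduli of its finitely many roots; by compactness of `|x| = r`, `q` has no zero
there for small `z`. -/
theorem exists_radii {f : MvPolynomial (Fin 2) ℂ} (hf : f ≠ 0) :
    ∃ r s : ℝ, 0 < r ∧ r < 1 / 3 ∧ 0 < s ∧ s < 1 / 3 ∧ ∀ x z : ℂ, ‖x‖ = r → ‖z‖ = s →
      MvPolynomial.eval ![x, yOf x z] f ≠ 0 := by
  obtain ⟨N, g, hg⟩ := exists_evalEval_eq f
  have hg0 : g ≠ 0 := by
    rintro rfl
    -- The coordinates `(x, z)` reach every `(x, y)` with `x (1 - x) ≠ 0`, so `g = 0` makes `f`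
    -- vanish off `x (1 - x) = 0`.
    have h0 : MvPolynomial.X 0 * (1 - MvPolynomial.X 0) * f = 0 := by
      refine MvPolynomial.funext fun v => ?_
      have hv : v = ![v 0, v 1] := by
        ext i
        fin_cases i <;> rfl
      simp only [map_mul, map_sub, map_one, map_zero, MvPolynomial.eval_X]
      rcases eq_or_ne (v 0) 0 with h | h
      · simp [h]
      rcases eq_or_ne (1 - v 0) 0 with h1 | h1
      · simp [h1]
      have h2 := hg (v 0) (zOf (v 0) (v 1)) h
      have h3 : yOf (v 0) (zOf (v 0) (v 1)) = v 1 := by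
        rw [yOf, zOf]
        field_simp
        ring
      rw [h3, ← hv, Polynomial.evalEval_zero] at h2
      rw [(mul_eq_zero.mp h2).resolve_left (pow_ne_zero _ (mul_ne_zero two_ne_zero h)), mul_zero]
    have hX : (1 - MvPolynomial.X 0 : MvPolynomial (Fin 2) ℂ) ≠ 0 := by
      intro h
      simpa using congrArg (MvPolynomial.eval 0) h
    exact mul_ne_zero (mul_ne_zero (MvPolynomial.X_ne_zero 0) hX) hf h0
  obtain ⟨q, hq, hdvd⟩ := g.exists_eq_pow_rootMultiplicity_mul_and_not_dvd hg0 0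
  rw [Polynomial.C_0, sub_zero] at hq hdvd
  rw [Polynomial.X_dvd_iff] at hdvd
  have hfin : ((fun x : ℂ => ‖x‖) '' {x | (q.coeff 0).IsRoot x}).Finite :=
    (Polynomial.finite_setOfPred_isRoot hdvd).image _
  obtain ⟨r, ⟨hr, hr3⟩, hrn⟩ := (Set.Ioo_infinite (by norm_num : (0 : ℝ) < 1 / 3)).exists_notMem_finite
    hfin
  have hev : ∀ᶠ z in nhds (0 : ℂ), ∀ x ∈ Metric.sphere (0 : ℂ) r, q.evalEval x z ≠ 0 := by
    refine (isCompact_sphere (0 : ℂ) r).eventually_forall_of_forall_eventually fun x hx => ?_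
    refine (continuous_evalEval q).continuousAt.eventually_ne ?_
    intro h
    refine hrn ⟨x, ?_, by simpa using hx⟩
    simpa [Polynomial.evalEval, ← Polynomial.coeff_zero_eq_eval_zero] using h
  obtain ⟨ε, hε, hball⟩ := Metric.eventually_nhds_iff.mp hev
  refine ⟨r, min (ε / 2) (1 / 4), hr, hr3, by positivity,
    (min_le_right _ _).trans_lt (by norm_num), fun x z hx hz hzero => ?_⟩
  have hx0 : x ≠ 0 := norm_pos_iff.mp (hx ▸ hr)
  have hz0 : z ≠ 0 := norm_pos_iff.mp (by rw [hz]; positivity)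
  have h1 : q.evalEval x z ≠ 0 := by
    refine hball ?_ x (by simpa using hx)
    rw [dist_zero_right, hz]
    exact (min_le_left _ _).trans_lt (by linarith)
  have h2 := hg x z hx0
  rw [hzero, mul_zero, hq, Polynomial.evalEval_mul, Polynomial.evalEval_pow,
    Polynomial.evalEval_X] at h2
  exact mul_ne_zero (pow_ne_zero _ hz0) h1 h2.symm

theorem isOpen_surfaceOpen (f : MvPolynomial (Fin 2) ℂ) : IsOpen (surfaceOpen f) := by
  have hv : Continuous fun p : ℂ × ℂ => (![p.1, p.2] : Fin 2 → ℂ) := by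
    refine continuous_pi fun i => ?_
    fin_cases i
    · exact continuous_fst
    · exact continuous_snd
  have hf : Continuous fun p : ℂ × ℂ => MvPolynomial.eval ![p.1, p.2] f :=
    (MvPolynomial.continuous_eval f).comp hv
  have o : ∀ {h : ℂ × ℂ → ℂ}, Continuous h → IsOpen {p | h p ≠ 0} := fun hh =>
    isOpen_ne_fun hh continuous_const
  exact (o continuous_fst).inter ((o continuous_snd).inter ((o (by fun_prop)).inter
    ((o (by fun_prop)).inter (o hf))))

theorem not_isExactFormOn_etaSurface {f : MvPolynomial (Fin 2) ℂ} (hf : f ≠ 0) :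
    ¬ IsExactFormOn etaSurface (surfaceOpen f) := by
  rintro ⟨φ, hφ, hφη⟩
  obtain ⟨r, s, hr, hr3, hs, hs3, hne⟩ := exists_radii hf
  have hmem : ∀ t, surfaceTorus r s t ∈ surfaceOpen f := by
    intro t
    have hx0 := circleMap_zero_ne_zero hr t.1
    have hx1 := one_sub_circleMap_ne_zero hr hr3 t.1
    have hWp := re_one_add_sub_pos (norm_circleMap_lt hr hr3 t.1) (norm_circleMap_lt hs hs3 t.2)
    refine ⟨hx0, ?_, hx1, ?_, hne _ _ ?_ ?_⟩
    · simp only [surfaceTorus, yOf_eq_neg_div]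
      refine div_ne_zero (neg_ne_zero.mpr fun h' => ?_) (mul_ne_zero two_ne_zero hx0)
      simp [h'] at hWp
    · simp only [surfaceTorus, one_add_add_two_mul_yOf hx0]
      exact mul_ne_zero hx1 (circleMap_zero_ne_zero hs t.2)
    · exact (norm_circleMap_zero r t.1).trans (abs_of_pos hr)
    · rw [norm_circleMap_zero, abs_of_pos hs]
  have hd : ∀ t, DifferentiableAt ℝ φ (surfaceTorus r s t) := fun t =>
    (hφ.contDiffAt ((isOpen_surfaceOpen f).mem_nhds (hmem t))).differentiableAt (by simp)
  have hpx := periodic_circleMap 0 r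
  have hpz := periodic_circleMap 0 s
  have h0 := integral_extDeriv_periodic_eq_zero (T := 2 * Real.pi) (contDiff_surfaceTorus hr s)
    (fun t => by simp [surfaceTorus, hpx t.1]) (fun t => by simp [surfaceTorus, hpz t.2]) hd
    (h := fun t => (torusFun r s (circleMap 0 r t.1) (circleMap 0 s t.2)).re)
    (Complex.continuous_re.comp (continuous_torusFun hr hr3 hs hs3))
    (fun t => by rw [hφη _ (hmem t), etaSurface_surfaceTorus hr hr3 hs hs3])
  rw [integral_re_torusFun hr hr3 hs hs3] at h0
  have hl : 0 < Real.log 2 := Real.log_pos (by norm_num)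
  have : 0 < 4 * Real.pi ^ 2 * Real.log 2 := by positivity
  linarith

/-! ### Assembly. -/

theorem riemannZeta_three : riemannZeta 3 = ((∑' n : ℕ, 1 / (n : ℝ) ^ 3 : ℝ) : ℂ) := by
  have h := zeta_nat_eq_tsum_of_gt_one (k := 3) (by norm_num)
  push_cast at h ⊢
  exact h

theorem mainTheorem9 :
    -- the Mahler measures
    (MeasureTheory.IntegrableOn (mahlerIntegrand polyP) (Set.Icc 0 1) ∧
      (logMahler polyP : ℂ) =
        7 / (2 * (Real.pi : ℂ) ^ 2) * riemannZeta 3 + (Real.log 2 : ℂ) / 2) ∧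
    (MeasureTheory.IntegrableOn (mahlerIntegrand polyQ) (Set.Icc 0 1) ∧
      (logMahler polyQ : ℂ) =
        7 / (2 * (Real.pi : ℂ) ^ 2) * riemannZeta 3 + (Real.log 2 : ℂ) / 2) ∧
    -- `η(x, y, z)` is not exact, not even at the generic point of the surface
    (∀ f : MvPolynomial (Fin 2) ℂ, f ≠ 0 → ¬ IsExactFormOn etaSurface (surfaceOpen f)) ∧
    -- the integral of `η(2, x, z)` over `B`, and its contribution to the Mahler measure
    MeasureTheory.IntegrableOn etaTwoCoeff regionB ∧
    (∫ t in regionB, etaTwoCoeff t) = -(2 * Real.pi ^ 2 * Real.log 2) ∧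
    4 * (Real.pi : ℂ) ^ 2 * (logMahler polyP : ℂ) =
      14 * riemannZeta 3 - ((∫ t in regionB, etaTwoCoeff t : ℝ) : ℂ) := by
  obtain ⟨hP, hP'⟩ := mahler_polyP
  obtain ⟨hQ, hQ'⟩ := mahler_polyQ
  obtain ⟨hη, hη'⟩ := integral_etaTwoCoeff
  have hpi : (Real.pi : ℂ) ≠ 0 := Complex.ofReal_ne_zero.mpr Real.pi_ne_zero
  refine ⟨⟨hP, ?_⟩, ⟨hQ, ?_⟩, fun f hf => not_isExactFormOn_etaSurface hf, hη, hη', ?_⟩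
  · rw [hP', riemannZeta_three]
    push_cast
    ring
  · rw [hQ', riemannZeta_three]
    push_cast
    ring
  · rw [hP', hη', riemannZeta_three]
    push_cast
    field_simp
    ring
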